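/- **Conventions.** Let $\hat f(\xi)=\frac1{\sqrt{2\pi}}\int_{\mathbb R} e^{-i\xi x}f(x)\,dx$, $\|f\|_{H^{-1}_\varkappa}^2=\int_{\mathbb R}\frac{|\hat f(\xi)|^2}{\xi^2+4\varkappa^2}\,d\xi$ and $\|f\|_{H^{-1}}^2=\int_{\mathbb R}\frac{|\hat f(\xi)|^2}{\xi^2+1}\,d\xi$, these norms being $+\infty$ when $f\notin H^{-1}(\mathbb R)$. Let $B_\delta=\{q\in H^{-1}(\mathbb R):\|q\|_{H^{-1}}<\delta\}$. For $\varkappa\ge 1$ let $R_0(\varkappa)=(-\partial_x^2+\varkappa^2)^{-1}$, with integral kernel $\frac1{2\varkappa}e^{-\varkappa|x-y|}$. For a real-valued Schwartz function $q$ that is small in $H^{-1}(\mathbb R)$, the diagonal Green's function of $-\partial_x^2+q$ at energy $-\varkappa^2$ is $$ g(x;\varkappa,q)=\langle\delta_x,(-\partial_x^2+q+\varkappa^2)^{-1}\delta_x\rangle=\frac1{2\varkappa}+\sum_{\ell\ge1}(-1)^\ell\bigl\langle\delta_x,\,(R_0(\varkappa)\,q)^\ell R_0(\varkappa)\,\delta_x\bigr\rangle,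 $$ and $$ \rho(x;\varkappa,q)=2\varkappa^2-\frac{\varkappa}{g(x;\varkappa,q)}+4\varkappa^2[R_0(2\varkappa)q](x). $$ **Lemma 5.2.** There are absolute constants $\delta>0$ and $\varkappa_0\ge1$ such that the following holds. Let $w:\mathbb R\to(0,\infty)$ be twice differentiable with $$ |w''(x)|+|w'(x)|\le w(x)\qquad\text{and}\qquad \frac{w(y)}{w(x)}\le e^{|x-y|/2}\qquad\text{for all }x,y\in\mathbb R. $$ Then for every $\varkappa\ge\varkappa_0$ and every real-valued Schwartz function $q\in B_\delta$, the series defining $g(x;\varkappa,q)$ converges and $g(x;\varkappa,q)>0$ for all $x\in\mathbb R$, and $$ \tfrac12\,\|wq\|_{H^{-1}_\varkappa(\mathbb R)}^2\;\le\;\|w^2\rho(\varkappa)\|_{L^1(\mathbb R)}\;\le\;2\,\|wq\|_{H^{-1}_\varkappa(\mathbb R)}^2 $$ as an inequality in $[0,\infty]$. In particular, $\varkappa_0$ does not depend on $w$ or $q$. -/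

import Mathlib

open MeasureTheory
open scoped ENNReal ContDiff SchwartzMap

namespace LineSchrodinger

noncomputable section

/-- `(2π)^{-1/2} ∫ e^{iξx} φ(x) dx`: the inverse Fourier transform of a test function, in the
unitary normalization `f̂(ξ) = (2π)^{-1/2} ∫ e^{-iξx} f(x) dx`. -/
def invFourier (φ : ℝ → ℂ) (ξ : ℝ) : ℂ :=
  ((Real.sqrt (2 * Real.pi))⁻¹ : ℝ) * ∫ x : ℝ, Complex.exp (Complex.I * ξ * x) * φ x

/-- The function `F` is the Fourier transform of the locally integrable function `f`, both read
as distributions: `∫ f φ = ∫ F φ̌` for all `φ ∈ C_c^∞(ℝ)`. Test functions of compact support are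
used because `f` may grow faster than polynomially, so that `∫ f φ` need not make sense for every
Schwartz function `φ`. -/
def IsFourierTransform (f F : ℝ → ℂ) : Prop :=
  ∀ φ : ℝ → ℂ, ContDiff ℝ ∞ φ → HasCompactSupport φ →
    ∫ x : ℝ, f x * φ x = ∫ ξ : ℝ, F ξ * invFourier φ ξ

/-- The norm `(∫ (ξ² + 4ϰ²)^s |f̂(ξ)|² dξ)^{1/2} ∈ [0, ∞]` of a locally integrable function `f` on
the line. It is `∞` when the distribution `f` is not in `H^s`. (Functions `F` for which the
weighted integral is infinite do not influence the infimum; those for which it is finite are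
integrable against the rapidly decreasing functions `φ̌`, and among these the Fourier transform
of `f` is unique up to null sets, so the infimum is over at most one finite value.) -/
def sobolevNorm (s ϰ : ℝ) (f : ℝ → ℝ) : ℝ≥0∞ :=
  (⨅ F ∈ {F : ℝ → ℂ | Measurable F ∧ IsFourierTransform (fun x => (f x : ℂ)) F},
    ∫⁻ ξ : ℝ, ENNReal.ofReal ((ξ ^ 2 + 4 * ϰ ^ 2) ^ s) * ‖F ξ‖ₑ ^ 2) ^ (1 / 2 : ℝ)

/-- The kernel `⟨δ_x, R₀(ϰ) δ_y⟩ = e^{-ϰ|x-y|} / (2ϰ)` of `R₀(ϰ) = (-∂² + ϰ²)⁻¹`. -/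
def freeKernel (ϰ x y : ℝ) : ℝ := Real.exp (-ϰ * |x - y|) / (2 * ϰ)

/-- The free resolvent `R₀(ϰ) = (-∂² + ϰ²)⁻¹` as an integral operator. -/
def freeResolvent (ϰ : ℝ) (f : ℝ → ℝ) (x : ℝ) : ℝ := ∫ y : ℝ, freeKernel ϰ x y * f y

/-- The `ℓ`-th term of the Neumann series for the integral kernel of
`R(ϰ) = (-∂² + q + ϰ²)⁻¹`, that is, the kernel at `(x, y)` of the operator
`(-1)^ℓ (R₀ q)^ℓ R₀ = (-1)^ℓ √R₀ (√R₀ q √R₀)^ℓ √R₀`. -/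
def neumannTerm (q : ℝ → ℝ) (ϰ : ℝ) (ℓ : ℕ) (x y : ℝ) : ℝ :=
  (-1) ^ ℓ * ((fun f : ℝ → ℝ => freeResolvent ϰ (fun z => q z * f z))^[ℓ]
    (fun z => freeKernel ϰ z y)) x

/-- The integral kernel `⟨δ_x, R(ϰ) δ_y⟩` of the resolvent `R(ϰ) = (-∂² + q + ϰ²)⁻¹`, which for
small `q` is constructed by its Neumann series. -/
def greenKernel (q : ℝ → ℝ) (ϰ x y : ℝ) : ℝ := ∑' ℓ : ℕ, neumannTerm q ϰ ℓ x y

/-- The diagonal Green's function `g(x; ϰ, q) = ⟨δ_x, R(ϰ) δ_x⟩`. Its term `ℓ = 0` is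
`1 / (2ϰ)`. -/
def diagGreen (q : ℝ → ℝ) (ϰ x : ℝ) : ℝ := greenKernel q ϰ x x

/-- The density `ρ(x; ϰ, q) = 2ϰ² - ϰ / g(x; ϰ, q) + 4ϰ² [R₀(2ϰ) q](x)`. -/
def density (q : ℝ → ℝ) (ϰ x : ℝ) : ℝ :=
  2 * ϰ ^ 2 - ϰ / diagGreen q ϰ x + 4 * ϰ ^ 2 * freeResolvent (2 * ϰ) q x

end

end LineSchrodinger

/-!
The proof replaces the diagonal Green's function by the two solutions `u`, `v ∈ L²(ℝ)` of the
Riccati equations `u' + 2ϰu + u² = q` and `-v' + 2ϰv + v² = q`, so that `ϰ + u` and `-(ϰ + v)` are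
the logarithmic derivatives of the solutions of `-ψ'' + (q + ϰ²)ψ = 0` that decay at `-∞` and at
`+∞`. In these terms `g = 1 / (2ϰ + u + v)`. Since `(∂ + 2ϰ)⁻¹ + (-∂ + 2ϰ)⁻¹ = 4ϰ R₀(2ϰ)`, the
linear terms in `ρ` cancel, and

  `ρ = ϰ ((∂ + 2ϰ)⁻¹ (u²) + (-∂ + 2ϰ)⁻¹ (v²)) ≥ 0`.

Tonelli's theorem and the slow variation of `w` give `‖w²ρ‖₁ ≈ ½ (‖wu‖₂² + ‖wv‖₂²)`
(`lintegral_weight_mul_causal`). It remains to compare `‖wu‖₂` with the `H⁻¹_ϰ` norm of `wq`. As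
`|iξ + 2ϰ|² = ξ² + 4ϰ²`, that norm is `‖(∂ + 2ϰ)⁻¹ (wq)‖₂` (`sobolevNorm_eq_eLpNorm`,
`exists_memLp_of_sobolevNorm_ne_top`), while `(∂ + 2ϰ)(wu) = wq - wu² + w'u`. Both errors are small
relative to `‖wu‖₂`: the first because `(∂ + 2ϰ)⁻¹ : L¹ → L²` has norm `(4ϰ)^{-1/2}` and `‖u‖₂` is
small, the second because `|w'| ≤ w` and `(∂ + 2ϰ)⁻¹ : L² → L²` has norm `1 / (2ϰ)`
(`sobolevNorm_le_of_riccati`, `eLpNorm_le_sobolevNorm_of_riccati`). The first bound also gives `u`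
by a contraction argument in `L²` (`exists_riccati`), with `v` obtained by reflection.

For the Neumann series, an explicit kernel `K` built from `u` and `v` satisfies the resolvent
equation `G = K + R₀ q K` (`IsRiccatiPair.freeKernel_eq`), where `G` is the kernel of `R₀`, and
`R₀ q` is a contraction in the energy norm `(∫ f'² + ϰ² f²)^{1/2}`, because `q = φ' + 2ϰφ` with
`‖φ‖₂ ≤ ‖q‖_{H⁻¹}` (`exists_iterate_neumannStep_le`). Iterating the resolvent equation makes the
series telescope to `K` (`hasSum_neumannTerm`). The values `δ = 1 / 10` and `ϰ₀ = 100` leave room in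
every estimate.
-/

namespace LineSchrodinger

open scoped FourierTransform

noncomputable section

/-! ### Plancherel's theorem in the unitary normalization -/

lemma integral_coe_fourierInv_mul (U : Lp ℂ 2 (volume : Measure ℝ)) {χ : ℝ → ℂ}
    (hχ : ContDiff ℝ ∞ χ) (hc : HasCompactSupport χ) :
    ∫ x : ℝ, (𝓕⁻ U : Lp ℂ 2 (volume : Measure ℝ)) x * χ x = ∫ η : ℝ, U η * 𝓕⁻ χ η := by
  have h := congrArg (fun T : 𝓢'(ℝ, ℂ) => T (hc.toSchwartzMap hχ))
    (Lp.fourierInv_toTemperedDistribution_eq U)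
  simp only [TemperedDistribution.fourierInv_apply, Lp.toTemperedDistribution_apply] at h
  simp only [SchwartzMap.fourierInv_coe, smul_eq_mul] at h
  have e : (⇑(hc.toSchwartzMap hχ) : ℝ → ℂ) = χ := by ext; simp
  rw [e] at h
  simp only [mul_comm _ (χ _)]
  rw [← h]
  simp only [mul_comm]

lemma invFourier_eq_fourierInv (φ : ℝ → ℂ) (ξ : ℝ) :
    invFourier φ ξ = ((Real.sqrt (2 * Real.pi))⁻¹ : ℝ) * 𝓕⁻ φ ((2 * Real.pi)⁻¹ * ξ) := by
  rw [invFourier, Real.fourierInv_eq']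
  congr 1
  refine integral_congr_ae (Filter.Eventually.of_forall fun x => ?_)
  have hpi : (Real.pi : ℂ) ≠ 0 := by exact_mod_cast Real.pi_ne_zero
  simp only [smul_eq_mul]
  congr 2
  simp only [RCLike.inner_apply, conj_trivial]
  push_cast
  field_simp

/-- Integration by parts: the inverse Fourier transform turns the transpose `a - ∂` of
`a + ∂` into multiplication by `a + iξ`. -/
lemma invFourier_transpose (a : ℝ) {φ : ℝ → ℂ} (hφ : ContDiff ℝ ∞ φ) (hc : HasCompactSupport φ)
    (ξ : ℝ) :
    invFourier (fun x => a * φ x - deriv φ x) ξ = (a + Complex.I * ξ) * invFourier φ ξ := by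
  have hd : Continuous (deriv φ) := hφ.continuous_deriv (by simp)
  have hφd : Differentiable ℝ φ := hφ.differentiable (by simp)
  have hE : Continuous fun x : ℝ => Complex.exp (Complex.I * ξ * x) := by fun_prop
  have hE' : ∀ x : ℝ, HasDerivAt (fun x : ℝ => Complex.exp (Complex.I * ξ * x))
      (Complex.I * ξ * Complex.exp (Complex.I * ξ * x)) x := by
    intro x
    have h1 : HasDerivAt (fun x : ℝ => Complex.I * ξ * (x : ℂ)) (Complex.I * ξ) x := by
      simpa using (Complex.ofRealCLM.hasDerivAt (x := x)).const_mul (Complex.I * (ξ : ℂ))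
    simpa [mul_comm] using h1.cexp
  have i1 : Integrable fun x : ℝ => Complex.exp (Complex.I * ξ * x) * φ x :=
    (hE.mul hφ.continuous).integrable_of_hasCompactSupport hc.mul_left
  have i2 : Integrable fun x : ℝ => Complex.exp (Complex.I * ξ * x) * deriv φ x :=
    (hE.mul hd).integrable_of_hasCompactSupport hc.deriv.mul_left
  have i3 : Integrable fun x : ℝ => Complex.I * ξ * Complex.exp (Complex.I * ξ * x) * φ x := by
    simpa only [mul_assoc] using i1.const_mul (Complex.I * ξ)
  have key := integral_mul_deriv_eq_deriv_mul_of_integrable (u := fun x : ℝ =>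
    Complex.exp (Complex.I * ξ * x)) (v := φ) (fun x _ => hE' x)
    (fun x _ => (hφd x).hasDerivAt) i2 i3 i1
  rw [invFourier, invFourier]
  have e : ∀ x : ℝ, Complex.exp (Complex.I * ξ * x) * (a * φ x - deriv φ x)
      = a * (Complex.exp (Complex.I * ξ * x) * φ x)
        - Complex.exp (Complex.I * ξ * x) * deriv φ x := fun x => by ring
  simp_rw [e]
  rw [integral_sub (i1.const_mul _) i2, key, integral_const_mul]
  simp_rw [mul_assoc (Complex.I * (ξ : ℂ))]
  rw [integral_const_mul]
  ring

lemma eLpNorm_two_sq {E : Type*} [NormedAddCommGroup E] (f : ℝ → E) :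
    eLpNorm f 2 volume ^ 2 = ∫⁻ x, ‖f x‖ₑ ^ 2 := by
  have := eLpNorm_nnreal_pow_eq_lintegral (f := f) (μ := volume) (p := 2) (by norm_num)
  simpa using this

lemma lintegral_comp_mul_left_of_pos {c : ℝ} (hc : 0 < c) (g : ℝ → ℝ≥0∞) :
    ∫⁻ x, g (c * x) = ENNReal.ofReal c⁻¹ * ∫⁻ x, g x := by
  have h := (Homeomorph.mulLeft₀ c hc.ne').measurableEmbedding.lintegral_map g
    (μ := (volume : Measure ℝ))
  have e : Measure.map (⇑(Homeomorph.mulLeft₀ c hc.ne')) (volume : Measure ℝ)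
      = ENNReal.ofReal c⁻¹ • volume := by
    have := Real.map_volume_mul_left hc.ne'
    rw [abs_of_pos (inv_pos.2 hc)] at this
    exact this
  rw [e, lintegral_smul_measure] at h
  simpa using h.symm

lemma memLp_two_iff_lintegral {E : Type*} [NormedAddCommGroup E] {f : ℝ → E} :
    MemLp f 2 volume ↔ AEStronglyMeasurable f volume ∧ ∫⁻ x, ‖f x‖ₑ ^ 2 < ⊤ := by
  rw [MemLp, ← eLpNorm_two_sq]
  simp

lemma memLp_comp_mul_left {V : ℝ → ℂ} (hV : MemLp V 2 volume) {c : ℝ} (hc : 0 < c) :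
    MemLp (fun η => (Real.sqrt c : ℂ) * V (c * η)) 2 volume ∧
      eLpNorm (fun η => (Real.sqrt c : ℂ) * V (c * η)) 2 volume = eLpNorm V 2 volume := by
  have hq : Measure.QuasiMeasurePreserving (fun η : ℝ => c * η) volume volume := by
    refine ⟨by fun_prop, ?_⟩
    rw [Real.map_volume_mul_left hc.ne']
    exact Measure.smul_absolutelyContinuous
  have e : eLpNorm (fun η => (Real.sqrt c : ℂ) * V (c * η)) 2 volume ^ 2
      = eLpNorm V 2 volume ^ 2 := by
    rw [eLpNorm_two_sq, eLpNorm_two_sq]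
    have h1 : ∀ x : ℝ, ‖(Real.sqrt c : ℂ) * V (c * x)‖ₑ ^ 2
        = ENNReal.ofReal c * ‖V (c * x)‖ₑ ^ 2 := by
      intro x
      rw [enorm_mul, mul_pow]
      congr 1
      rw [← ofReal_norm, Complex.norm_real, Real.norm_of_nonneg (Real.sqrt_nonneg _),
        ← ENNReal.ofReal_pow (Real.sqrt_nonneg _), Real.sq_sqrt hc.le]
    simp_rw [h1]
    rw [lintegral_const_mul' _ _ ENNReal.ofReal_ne_top,
      lintegral_comp_mul_left_of_pos hc (fun x => ‖V x‖ₑ ^ 2), ← mul_assoc,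
      ← ENNReal.ofReal_mul hc.le, mul_inv_cancel₀ hc.ne']
    simp
  have e' := (ENNReal.pow_right_strictMono (n := 2) (by norm_num)).injective e
  refine ⟨⟨?_, ?_⟩, e'⟩
  · exact (hV.1.comp_quasiMeasurePreserving hq).const_mul _
  · rw [e']; exact hV.2

/-- Every `V ∈ L²` is the unitary Fourier transform of some `v ∈ L²` of the same norm. -/
lemma exists_inverse_fourier_memLp {V : ℝ → ℂ} (hV : MemLp V 2 volume) :
    ∃ v : ℝ → ℂ, MemLp v 2 volume ∧ eLpNorm v 2 volume = eLpNorm V 2 volume ∧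
      IsFourierTransform v V := by
  have hpi : (0 : ℝ) < 2 * Real.pi := by positivity
  obtain ⟨h1, h2⟩ := memLp_comp_mul_left hV hpi
  set U : Lp ℂ 2 (volume : Measure ℝ) := h1.toLp _ with hU
  refine ⟨(𝓕⁻ U : Lp ℂ 2 (volume : Measure ℝ)), Lp.memLp _, ?_, ?_⟩
  · have e : ‖(𝓕⁻ U : Lp ℂ 2 (volume : Measure ℝ))‖ = ‖U‖ := by
      rw [← Lp.norm_fourier_eq, FourierTransform.fourier_fourierInv_eq]
    rw [Lp.norm_def (μ := volume), Lp.norm_def (μ := volume)] at e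
    have e' := (ENNReal.toReal_eq_toReal_iff' (Lp.eLpNorm_ne_top (μ := volume) _)
      (Lp.eLpNorm_ne_top (μ := volume) _)).1 e
    rw [e', eLpNorm_congr_ae h1.coeFn_toLp, h2]
  · intro φ hφ hc
    rw [integral_coe_fourierInv_mul U hφ hc]
    have e1 : ∫ η : ℝ, U η * 𝓕⁻ φ η
        = ∫ η : ℝ, (Real.sqrt (2 * Real.pi) : ℂ) * V ((2 * Real.pi) * η) * 𝓕⁻ φ η := by
      refine integral_congr_ae ?_
      filter_upwards [h1.coeFn_toLp] with η hη
      rw [hη]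
    have e2 : ∀ η : ℝ, (Real.sqrt (2 * Real.pi) : ℂ) * V ((2 * Real.pi) * η) * 𝓕⁻ φ η
        = (fun ξ => (2 * Real.pi : ℝ) * (V ξ * invFourier φ ξ)) ((2 * Real.pi) * η) := by
      intro η
      simp only [invFourier_eq_fourierInv, inv_mul_cancel_left₀ hpi.ne']
      have hs : (2 * Real.pi : ℝ) = Real.sqrt (2 * Real.pi) * Real.sqrt (2 * Real.pi) :=
        (Real.mul_self_sqrt hpi.le).symm
      have hs0 : (Real.sqrt (2 * Real.pi) : ℂ) ≠ 0 := by
        exact_mod_cast (Real.sqrt_pos.2 hpi).ne'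
      have hs' : ((2 * Real.pi : ℝ) : ℂ)
          = (Real.sqrt (2 * Real.pi) : ℂ) * Real.sqrt (2 * Real.pi) := by
        exact_mod_cast hs
      rw [hs']
      push_cast
      field_simp
    rw [e1]
    rw [integral_congr_ae (Filter.Eventually.of_forall e2)]
    refine (Measure.integral_comp_mul_left
      (fun ξ => ((2 * Real.pi : ℝ) : ℂ) * (V ξ * invFourier φ ξ)) _).trans ?_
    rw [integral_const_mul, abs_of_pos (inv_pos.2 hpi),
      Complex.real_smul, ← mul_assoc, ← Complex.ofReal_mul, inv_mul_cancel₀ hpi.ne']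
    simp

/-- Every `v ∈ L²` has a Borel measurable unitary Fourier transform of the same norm. -/
lemma exists_fourier_memLp {v : ℝ → ℂ} (hv : MemLp v 2 volume) :
    ∃ V : ℝ → ℂ, Measurable V ∧ MemLp V 2 volume ∧ eLpNorm V 2 volume = eLpNorm v 2 volume ∧
      IsFourierTransform v V := by
  have hpi : (0 : ℝ) < 2 * Real.pi := by positivity
  set U : Lp ℂ 2 (volume : Measure ℝ) := 𝓕 (hv.toLp v) with hU
  have hUm := Lp.stronglyMeasurable U
  obtain ⟨h1, h2⟩ := memLp_comp_mul_left (Lp.memLp U) (inv_pos.2 hpi)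
  have e : ‖U‖ = ‖hv.toLp v‖ := by rw [hU, Lp.norm_fourier_eq]
  rw [Lp.norm_def (μ := volume), Lp.norm_def (μ := volume)] at e
  have e' := (ENNReal.toReal_eq_toReal_iff' (Lp.eLpNorm_ne_top (μ := volume) _)
      (Lp.eLpNorm_ne_top (μ := volume) _)).1 e
  rw [eLpNorm_congr_ae hv.coeFn_toLp] at e'
  refine ⟨_, ?_, h1, h2.trans e', ?_⟩
  · exact (hUm.measurable.comp (measurable_const_mul _)).const_mul _
  · intro φ hφ hc
    have k := integral_coe_fourierInv_mul U hφ hc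
    rw [hU, FourierTransform.fourierInv_fourier_eq, ← hU] at k
    have e1 : ∫ x : ℝ, v x * φ x = ∫ x : ℝ, hv.toLp v x * φ x := by
      refine integral_congr_ae ?_
      filter_upwards [hv.coeFn_toLp] with η hη
      rw [hη]
    have e2 : ∀ ξ : ℝ, (Real.sqrt (2 * Real.pi)⁻¹ : ℂ) * U ((2 * Real.pi)⁻¹ * ξ) * invFourier φ ξ
        = (fun η => (2 * Real.pi : ℝ)⁻¹ * (U η * 𝓕⁻ φ η)) ((2 * Real.pi)⁻¹ * ξ) := by
      intro ξ
      simp only [invFourier_eq_fourierInv]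
      rw [Real.sqrt_inv]
      have hs : (2 * Real.pi : ℝ)⁻¹
          = (Real.sqrt (2 * Real.pi))⁻¹ * (Real.sqrt (2 * Real.pi))⁻¹ := by
        rw [← mul_inv, Real.mul_self_sqrt hpi.le]
      have hs' : ((2 * Real.pi : ℝ)⁻¹ : ℝ)
          = (((Real.sqrt (2 * Real.pi))⁻¹ : ℝ) * ((Real.sqrt (2 * Real.pi))⁻¹ : ℝ) : ℂ) := by
        exact_mod_cast hs
      rw [hs']
      ring
    rw [e1, k]
    rw [integral_congr_ae (Filter.Eventually.of_forall e2)]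
    refine ((Measure.integral_comp_mul_left
      (fun η => (((2 * Real.pi : ℝ)⁻¹ : ℝ) : ℂ) * (U η * 𝓕⁻ φ η)) _).trans ?_).symm
    rw [integral_const_mul, inv_inv, abs_of_pos hpi,
      Complex.real_smul, ← mul_assoc, ← Complex.ofReal_mul, mul_inv_cancel₀ hpi.ne']
    simp

/-! ### The `H⁻¹` norm as the `L²` norm of a solution of a first-order equation -/

lemma exists_contDiff_hasDerivAt_of_integral_eq_zero {ζ : ℝ → ℝ} (hζ : ContDiff ℝ ∞ ζ)
    (hc : HasCompactSupport ζ) (h0 : ∫ x, ζ x = 0) :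
    ∃ η : ℝ → ℝ, ContDiff ℝ ∞ η ∧ HasCompactSupport η ∧ ∀ x, HasDerivAt η (ζ x) x := by
  obtain ⟨R, hR⟩ := hc.isCompact.isBounded.subset_closedBall 0
  have hz : ∀ x, R < |x| → ζ x = 0 := by
    intro x hx
    by_contra h
    have := hR (subset_tsupport _ h)
    rw [mem_closedBall_zero_iff, Real.norm_eq_abs] at this
    linarith
  have hi : Integrable ζ := hζ.continuous.integrable_of_hasCompactSupport hc
  have hd : ∀ x, HasDerivAt (fun x => ∫ t in Set.Iic x, ζ t) (ζ x) x := by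
    intro x
    have e : (fun x => ∫ t in Set.Iic x, ζ t)
        = fun x => (∫ t in Set.Iic 0, ζ t) + ∫ t in (0 : ℝ)..x, ζ t := by
      ext y
      rw [← intervalIntegral.integral_Iic_sub_Iic hi.integrableOn hi.integrableOn]
      ring
    rw [e]
    exact (intervalIntegral.integral_hasDerivAt_right
      (hζ.continuous.intervalIntegrable _ _) (hζ.continuous.stronglyMeasurableAtFilter _ _)
      hζ.continuous.continuousAt).const_add _
  refine ⟨fun x => ∫ t in Set.Iic x, ζ t, ?_, ?_, hd⟩
  · rw [contDiff_infty_iff_deriv]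
    refine ⟨fun x => (hd x).differentiableAt, ?_⟩
    rwa [show deriv (fun x => ∫ t in Set.Iic x, ζ t) = ζ from funext fun x => (hd x).deriv]
  · refine HasCompactSupport.intro (isCompact_closedBall (0 : ℝ) R) fun x hx => ?_
    rw [mem_closedBall_zero_iff, Real.norm_eq_abs, not_le] at hx
    rcases le_or_gt 0 x with h | h
    · rw [abs_of_nonneg h] at hx
      rw [← h0]
      refine setIntegral_eq_integral_of_forall_compl_eq_zero fun t ht => hz t ?_
      exact hx.trans ((not_le.1 ht).trans_le (le_abs_self t))
    · rw [abs_of_neg h] at hx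
      refine setIntegral_eq_zero_of_forall_eq_zero fun t ht => hz t ?_
      exact hx.trans_le ((neg_le_neg ht).trans (neg_le_abs t))

/-- A locally integrable function whose distributional derivative vanishes is constant. -/
lemma ae_eq_const_of_integral_mul_deriv_eq_zero {H : ℝ → ℂ} (hH : LocallyIntegrable H)
    (h : ∀ η ζ : ℝ → ℝ, ContDiff ℝ ∞ η → HasCompactSupport η → (∀ x, HasDerivAt η (ζ x) x) →
      ∫ x, ζ x • H x = 0) : ∃ c : ℂ, ∀ᵐ x, H x = c := by
  let b : ContDiffBump (0 : ℝ) := default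
  let ρ₀ : ℝ → ℝ := b.normed volume
  have hρ : ContDiff ℝ ∞ ρ₀ := b.contDiff_normed
  have hρc : HasCompactSupport ρ₀ := b.hasCompactSupport_normed
  have hρ1 : ∫ x, ρ₀ x = 1 := b.integral_normed
  have hiρ : Integrable ρ₀ := hρ.continuous.integrable_of_hasCompactSupport hρc
  refine ⟨∫ x, ρ₀ x • H x, ?_⟩
  have key := ae_eq_zero_of_integral_contDiff_smul_eq_zero
    (f := fun x => H x - ∫ x, ρ₀ x • H x) (μ := volume)
    (hH.sub (locallyIntegrable_const _)) ?_
  · filter_upwards [key] with x hx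
    exact sub_eq_zero.1 hx
  intro g hg hgc
  have hig : Integrable g := hg.continuous.integrable_of_hasCompactSupport hgc
  have hgH : Integrable fun x => g x • H x :=
    hH.integrable_smul_left_of_hasCompactSupport hg.continuous hgc
  have hρH : Integrable fun x => ρ₀ x • H x :=
    hH.integrable_smul_left_of_hasCompactSupport hρ.continuous hρc
  obtain ⟨η, h1, h2, h3⟩ := exists_contDiff_hasDerivAt_of_integral_eq_zero
    (ζ := fun x => g x - (∫ t, g t) * ρ₀ x) (hg.sub (contDiff_const.mul hρ))
    (hgc.sub hρc.mul_left) (by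
      rw [integral_sub hig (hiρ.const_mul _), integral_const_mul, hρ1]; ring)
  have h4 := h η _ h1 h2 h3
  simp_rw [sub_smul, mul_smul] at h4
  have hρH' : Integrable fun x => (∫ t, g t) • ρ₀ x • H x :=
    hρH.fun_smul _
  rw [integral_sub hgH hρH', integral_smul] at h4
  simp_rw [smul_sub]
  rw [integral_sub hgH (hig.smul_const (∫ x, ρ₀ x • H x)), integral_smul_const]
  exact h4

/-- The distributional solutions of `h' + a h = 0` are the multiples of `e^{-ax}`. -/
lemma ae_eq_exp_of_integral_transpose_eq_zero (a : ℝ) {h : ℝ → ℂ} (hh : LocallyIntegrable h)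
    (h0 : ∀ φ : ℝ → ℂ, ContDiff ℝ ∞ φ → HasCompactSupport φ →
      ∫ x, h x * (a * φ x - deriv φ x) = 0) :
    ∃ c : ℂ, ∀ᵐ x : ℝ, h x = c * Real.exp (-a * x) := by
  have hexp : ∀ x : ℝ, HasDerivAt (fun x : ℝ => Real.exp (a * x)) (a * Real.exp (a * x)) x := by
    intro x
    have h1 : HasDerivAt (fun x : ℝ => a * x) a x := by
      simpa using (hasDerivAt_id x).const_mul a
    simpa [mul_comm] using h1.exp
  have hH : LocallyIntegrable fun x : ℝ => Real.exp (a * x) • h x := by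
    rw [← locallyIntegrableOn_univ] at hh ⊢
    exact hh.continuousOn_smul isOpen_univ.isLocallyClosed (by fun_prop)
  obtain ⟨c, hc⟩ := ae_eq_const_of_integral_mul_deriv_eq_zero hH (by
    intro η ζ hη hηc hd
    have hφd : ∀ x, HasDerivAt (fun x : ℝ => ((Real.exp (a * x) * η x : ℝ) : ℂ))
        ((a * Real.exp (a * x) * η x + Real.exp (a * x) * ζ x : ℝ) : ℂ) x :=
      fun x => ((hexp x).mul (hd x)).ofReal_comp
    have hφ : ContDiff ℝ ∞ fun x : ℝ => ((Real.exp (a * x) * η x : ℝ) : ℂ) :=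
      Complex.ofRealCLM.contDiff.comp
        ((Real.contDiff_exp.comp (contDiff_const.mul contDiff_id)).mul hη)
    have hφc : HasCompactSupport fun x : ℝ => ((Real.exp (a * x) * η x : ℝ) : ℂ) :=
      (hηc.mul_left (f := fun x : ℝ => Real.exp (a * x))).comp_left (g := Complex.ofReal) (by simp)
    have := h0 _ hφ hφc
    rw [← neg_eq_zero, ← integral_neg, ← this]
    refine integral_congr_ae (Filter.Eventually.of_forall fun x => ?_)
    simp only [(hφd x).deriv, Complex.real_smul]
    push_cast
    ring)
  refine ⟨c, ?_⟩
  filter_upwards [hc] with x hx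
  rw [← hx, Complex.real_smul, mul_comm, ← mul_assoc, ← Complex.ofReal_mul, ← Real.exp_add]
  simp

lemma eq_zero_of_exp_memLp {a : ℝ} (ha : 0 < a) {c : ℂ} {u : ℝ → ℂ} (hu : MemLp u 2 volume)
    (h : ∀ᵐ x : ℝ, u x = c * Real.exp (-a * x)) : c = 0 := by
  by_contra hc
  have h1 := (memLp_two_iff_lintegral.1 hu).2
  have h2 : ∫⁻ x in Set.Iic (0 : ℝ), ‖c‖ₑ ^ 2 ≤ ∫⁻ x, ‖u x‖ₑ ^ 2 := by
    refine le_trans ?_ (setLIntegral_le_lintegral (Set.Iic 0) _)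
    refine lintegral_mono_ae ?_
    filter_upwards [ae_restrict_of_ae h, ae_restrict_mem measurableSet_Iic] with x hx hx0
    rw [hx, enorm_mul]
    gcongr
    have : (1 : ℝ≥0∞) ≤ ‖((Real.exp (-a * x) : ℝ) : ℂ)‖ₑ := by
      rw [← ofReal_norm, Complex.norm_real, Real.norm_of_nonneg (Real.exp_pos _).le,
        ← ENNReal.ofReal_one]
      apply ENNReal.ofReal_le_ofReal
      rw [Real.one_le_exp_iff]
      have : x ≤ 0 := hx0
      nlinarith
    calc ‖c‖ₑ = ‖c‖ₑ * 1 := (mul_one _).symm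
      _ ≤ _ := by gcongr
  rw [setLIntegral_const, Real.volume_Iic, ENNReal.mul_top (by simpa using hc)] at h2
  exact absurd (lt_of_le_of_lt h2 h1) (lt_irrefl _)

/-- Integration by parts for a classical solution of `v' + a v = f`. -/
lemma integral_mul_eq_integral_transpose {a : ℝ} {f v : ℝ → ℝ} (hf : Continuous f)
    (hv : ∀ x, HasDerivAt v (f x - a * v x) x) {φ : ℝ → ℂ} (hφ : ContDiff ℝ ∞ φ)
    (hc : HasCompactSupport φ) :
    ∫ x, (f x : ℂ) * φ x = ∫ x, (v x : ℂ) * (a * φ x - deriv φ x) := by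
  have hvc : Continuous v := continuous_iff_continuousAt.2 fun x => (hv x).continuousAt
  have hd : Continuous (deriv φ) := hφ.continuous_deriv (by simp)
  have hφd : Differentiable ℝ φ := hφ.differentiable (by simp)
  have hφc := hφ.continuous
  have i1 : Integrable fun x : ℝ => (v x : ℂ) * φ x :=
    (by fun_prop : Continuous _).integrable_of_hasCompactSupport hc.mul_left
  have i2 : Integrable fun x : ℝ => (v x : ℂ) * deriv φ x :=
    (by fun_prop : Continuous _).integrable_of_hasCompactSupport hc.deriv.mul_left
  have i3 : Integrable fun x : ℝ => ((f x - a * v x : ℝ) : ℂ) * φ x :=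
    (by fun_prop : Continuous _).integrable_of_hasCompactSupport hc.mul_left
  have key := integral_mul_deriv_eq_deriv_mul_of_integrable (u := fun x : ℝ => (v x : ℂ))
    (v := φ) (fun x _ => (hv x).ofReal_comp) (fun x _ => (hφd x).hasDerivAt) i2 i3 i1
  have e1 : ∀ x, (v x : ℂ) * (a * φ x - deriv φ x)
      = a * ((v x : ℂ) * φ x) - (v x : ℂ) * deriv φ x := fun x => by ring
  have e2 : ∀ x, (f x : ℂ) * φ x = a * ((v x : ℂ) * φ x) + ((f x - a * v x : ℝ) : ℂ) * φ x :=
    fun x => by push_cast; ring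
  simp_rw [e1, e2]
  rw [integral_add (i1.const_mul _) i3, integral_sub (i1.const_mul _) i2, key]
  ring

lemma weight_mul_enorm_sq (ϰ : ℝ) (F : ℝ → ℂ) (ξ : ℝ) :
    ENNReal.ofReal ((ξ ^ 2 + 4 * ϰ ^ 2) ^ (-1 : ℝ)) * ‖F ξ‖ₑ ^ 2
      = ‖F ξ / (((2 * ϰ : ℝ) : ℂ) + Complex.I * ξ)‖ₑ ^ 2 := by
  have h1 : ‖((2 * ϰ : ℝ) : ℂ) + Complex.I * ξ‖ ^ 2 = ξ ^ 2 + 4 * ϰ ^ 2 := by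
    rw [← Complex.normSq_eq_norm_sq, mul_comm Complex.I, Complex.normSq_add_mul_I]
    ring
  rw [Real.rpow_neg_one, ← h1, ← ofReal_norm, ← ofReal_norm, ← ENNReal.ofReal_pow (norm_nonneg _),
    ← ENNReal.ofReal_pow (norm_nonneg _), ← ENNReal.ofReal_mul (by positivity), norm_div]
  congr 1
  rw [div_pow, div_eq_inv_mul]

lemma const_add_I_mul_ne_zero {a : ℝ} (ha : 0 < a) (ξ : ℝ) : (a : ℂ) + Complex.I * ξ ≠ 0 := by
  intro h
  have := congrArg Complex.re h
  simp at this
  exact ha.ne' this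

/-- A Fourier transform `F` of `f` for which the weighted integral is finite comes from a
distributional solution `v ∈ L²` of `v' + 2ϰ v = f`. -/
lemma exists_memLp_of_isFourierTransform {ϰ : ℝ} (hϰ : 0 < ϰ) {f F : ℝ → ℂ} (hF : Measurable F)
    (h : IsFourierTransform f F)
    (hfin : ∫⁻ ξ : ℝ, ENNReal.ofReal ((ξ ^ 2 + 4 * ϰ ^ 2) ^ (-1 : ℝ)) * ‖F ξ‖ₑ ^ 2 ≠ ⊤) :
    ∃ v : ℝ → ℂ, MemLp v 2 volume ∧
      eLpNorm v 2 volume ^ 2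
        = ∫⁻ ξ : ℝ, ENNReal.ofReal ((ξ ^ 2 + 4 * ϰ ^ 2) ^ (-1 : ℝ)) * ‖F ξ‖ₑ ^ 2 ∧
      ∀ φ : ℝ → ℂ, ContDiff ℝ ∞ φ → HasCompactSupport φ →
        ∫ x, f x * φ x = ∫ x, v x * ((2 * ϰ : ℝ) * φ x - deriv φ x) := by
  simp_rw [weight_mul_enorm_sq ϰ] at hfin ⊢
  have hV : MemLp (fun ξ : ℝ => F ξ / (((2 * ϰ : ℝ) : ℂ) + Complex.I * ξ)) 2 volume :=
    memLp_two_iff_lintegral.2 ⟨(hF.div (by fun_prop)).aestronglyMeasurable, hfin.lt_top⟩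
  obtain ⟨v, hv, hn, hFT⟩ := exists_inverse_fourier_memLp hV
  refine ⟨v, hv, by rw [hn, eLpNorm_two_sq], fun φ hφ hc => ?_⟩
  have hd : ContDiff ℝ ∞ (deriv φ) := (contDiff_infty_iff_deriv.1 hφ).2
  rw [h φ hφ hc, hFT (fun x => ((2 * ϰ : ℝ) : ℂ) * φ x - deriv φ x)
    ((contDiff_const.mul hφ).sub hd) (hc.mul_left.sub hc.deriv)]
  refine integral_congr_ae (Filter.Eventually.of_forall fun ξ => ?_)
  simp only [invFourier_transpose _ hφ hc]
  rw [← mul_assoc, div_mul_cancel₀ _ (const_add_I_mul_ne_zero (by positivity) ξ)]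

/-- If `v ∈ L²` solves `v' + 2ϰ v = f` classically, the `H⁻¹_ϰ` norm of `f` is `‖v‖₂`. -/
lemma sobolevNorm_eq_eLpNorm {ϰ : ℝ} (hϰ : 0 < ϰ) {f v : ℝ → ℝ} (hf : Continuous f)
    (hv : ∀ x, HasDerivAt v (f x - 2 * ϰ * v x) x) (hv2 : MemLp v 2 volume) :
    sobolevNorm (-1) ϰ f = eLpNorm v 2 volume := by
  have hvC : MemLp (fun x => (v x : ℂ)) 2 volume := hv2.ofReal
  have hnC : eLpNorm (fun x => (v x : ℂ)) 2 volume = eLpNorm v 2 volume :=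
    eLpNorm_congr_norm_ae (Filter.Eventually.of_forall fun x => by simp)
  have main : (⨅ F ∈ {F : ℝ → ℂ | Measurable F ∧ IsFourierTransform (fun x => (f x : ℂ)) F},
      ∫⁻ ξ : ℝ, ENNReal.ofReal ((ξ ^ 2 + 4 * ϰ ^ 2) ^ (-1 : ℝ)) * ‖F ξ‖ₑ ^ 2)
      = eLpNorm v 2 volume ^ 2 := by
    apply le_antisymm
    · obtain ⟨V, hVm, -, hVn, hVF⟩ := exists_fourier_memLp hvC
      have hmem : (fun ξ : ℝ => (((2 * ϰ : ℝ) : ℂ) + Complex.I * ξ) * V ξ) ∈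
          {F : ℝ → ℂ | Measurable F ∧ IsFourierTransform (fun x => (f x : ℂ)) F} := by
        refine ⟨by fun_prop, fun φ hφ hc => ?_⟩
        have hd : ContDiff ℝ ∞ (deriv φ) := (contDiff_infty_iff_deriv.1 hφ).2
        rw [integral_mul_eq_integral_transpose hf hv hφ hc,
          hVF (fun x => ((2 * ϰ : ℝ) : ℂ) * φ x - deriv φ x)
            ((contDiff_const.mul hφ).sub hd) (hc.mul_left.sub hc.deriv)]
        refine integral_congr_ae (Filter.Eventually.of_forall fun ξ => ?_)
        simp only [invFourier_transpose _ hφ hc]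
        ring
      refine (iInf₂_le _ hmem).trans (le_of_eq ?_)
      rw [← hnC, ← hVn, eLpNorm_two_sq]
      refine lintegral_congr fun ξ => ?_
      rw [weight_mul_enorm_sq ϰ (fun ξ : ℝ => (((2 * ϰ : ℝ) : ℂ) + Complex.I * ξ) * V ξ),
        mul_div_cancel_left₀ _ (const_add_I_mul_ne_zero (by positivity) ξ)]
    · refine le_iInf₂ fun F hF => ?_
      by_cases hfin : ∫⁻ ξ : ℝ, ENNReal.ofReal ((ξ ^ 2 + 4 * ϰ ^ 2) ^ (-1 : ℝ)) * ‖F ξ‖ₑ ^ 2 = ⊤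
      · rw [hfin]; exact le_top
      obtain ⟨v', hv', hn, hd⟩ := exists_memLp_of_isFourierTransform hϰ hF.1 hF.2 hfin
      have hl : ∀ {g : ℝ → ℂ}, MemLp g 2 volume → LocallyIntegrable g :=
        fun hg => hg.locallyIntegrable (by norm_num)
      obtain ⟨c, hc⟩ := ae_eq_exp_of_integral_transpose_eq_zero (2 * ϰ)
        (h := fun x => (v x : ℂ) - v' x) ((hl hvC).sub (hl hv')) (by
          intro φ hφ hφc
          have hφd : Continuous (deriv φ) := hφ.continuous_deriv (by simp)
          have hφ0 := hφ.continuous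
          have hχ : Continuous fun x => ((2 * ϰ : ℝ) : ℂ) * φ x - deriv φ x := by fun_prop
          have hχc : HasCompactSupport fun x => ((2 * ϰ : ℝ) : ℂ) * φ x - deriv φ x :=
            hφc.mul_left.sub hφc.deriv
          have i : ∀ {g : ℝ → ℂ}, MemLp g 2 volume →
              Integrable fun x => g x * (((2 * ϰ : ℝ) : ℂ) * φ x - deriv φ x) := by
            intro g hg
            have := (hl hg).integrable_smul_left_of_hasCompactSupport hχ hχc
            simpa only [smul_eq_mul, mul_comm] using this
          simp_rw [sub_mul]
          rw [integral_sub (i hvC) (i hv'), ← hd φ hφ hφc,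
            integral_mul_eq_integral_transpose hf hv hφ hφc, sub_self])
      have hc0 := eq_zero_of_exp_memLp (by positivity) (hvC.sub hv') hc
      rw [← hn, ← hnC]
      refine le_of_eq (congrArg (· ^ 2) (eLpNorm_congr_ae ?_))
      filter_upwards [hc] with x hx
      rw [hc0, zero_mul] at hx
      exact sub_eq_zero.1 hx
  rw [sobolevNorm, main, ← ENNReal.rpow_natCast, ← ENNReal.rpow_mul]
  norm_num

/-- The classical solution of `v' + a v = f` with `v 0 = c`. -/
lemma hasDerivAt_exp_mul_primitive (a c : ℝ) {f : ℝ → ℝ} (hf : Continuous f) (x : ℝ) :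
    HasDerivAt (fun x => Real.exp (-a * x) * (c + ∫ t in (0 : ℝ)..x, Real.exp (a * t) * f t))
      (f x - a * (Real.exp (-a * x) * (c + ∫ t in (0 : ℝ)..x, Real.exp (a * t) * f t))) x := by
  have h1 : HasDerivAt (fun x : ℝ => Real.exp (-a * x)) (Real.exp (-a * x) * -a) x := by
    have h1 : HasDerivAt (fun x : ℝ => -a * x) (-a) x := by
      simpa using (hasDerivAt_id x).const_mul (-a)
    exact h1.exp
  have hc : Continuous fun t => Real.exp (a * t) * f t := by fun_prop
  have h2 := (intervalIntegral.integral_hasDerivAt_right (hc.intervalIntegrable 0 x)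
    (hc.stronglyMeasurableAtFilter _ _) hc.continuousAt).const_add c
  convert! h1.mul h2 using 1
  have : Real.exp (-a * x) * Real.exp (a * x) = 1 := by rw [← Real.exp_add]; simp
  linear_combination (-f x) * this

/-- If the `H⁻¹_ϰ` norm of `f` is finite, then `v' + 2ϰ v = f` has a solution in `L²`. -/
lemma exists_memLp_of_sobolevNorm_ne_top {ϰ : ℝ} (hϰ : 0 < ϰ) {f : ℝ → ℝ} (hf : Continuous f)
    (h : sobolevNorm (-1) ϰ f ≠ ⊤) :
    ∃ v : ℝ → ℝ, (∀ x, HasDerivAt v (f x - 2 * ϰ * v x) x) ∧ MemLp v 2 volume := by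
  have h' : ∃ F ∈ {F : ℝ → ℂ | Measurable F ∧ IsFourierTransform (fun x => (f x : ℂ)) F},
      ∫⁻ ξ : ℝ, ENNReal.ofReal ((ξ ^ 2 + 4 * ϰ ^ 2) ^ (-1 : ℝ)) * ‖F ξ‖ₑ ^ 2 ≠ ⊤ := by
    by_contra! hcon
    apply h
    rw [sobolevNorm, iInf₂_eq_top.2 hcon]
    exact ENNReal.top_rpow_of_pos (by norm_num)
  obtain ⟨F, hF, hfin⟩ := h'
  obtain ⟨v', hv', -, hd⟩ := exists_memLp_of_isFourierTransform hϰ hF.1 hF.2 hfin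
  have hv0 := hasDerivAt_exp_mul_primitive (2 * ϰ) 0 hf
  set v₀ : ℝ → ℝ := fun x => Real.exp (-(2 * ϰ) * x) *
    (0 + ∫ t in (0 : ℝ)..x, Real.exp ((2 * ϰ) * t) * f t) with hv₀
  have hv0c : Continuous v₀ := continuous_iff_continuousAt.2 fun x => (hv0 x).continuousAt
  have hv0C : Continuous fun x => (v₀ x : ℂ) := by fun_prop
  have hl : LocallyIntegrable v' := hv'.locallyIntegrable (by norm_num)
  obtain ⟨c, hc⟩ := ae_eq_exp_of_integral_transpose_eq_zero (2 * ϰ)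
    (h := fun x => v' x - (v₀ x : ℂ)) (hl.sub hv0C.locallyIntegrable) (by
      intro φ hφ hφc
      have hφd : Continuous (deriv φ) := hφ.continuous_deriv (by simp)
      have hφ0 := hφ.continuous
      have hχ : Continuous fun x => ((2 * ϰ : ℝ) : ℂ) * φ x - deriv φ x := by fun_prop
      have hχc : HasCompactSupport fun x => ((2 * ϰ : ℝ) : ℂ) * φ x - deriv φ x :=
        hφc.mul_left.sub hφc.deriv
      have i : ∀ {g : ℝ → ℂ}, LocallyIntegrable g →
          Integrable fun x => g x * (((2 * ϰ : ℝ) : ℂ) * φ x - deriv φ x) := by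
        intro g hg
        have := hg.integrable_smul_left_of_hasCompactSupport hχ hχc
        simpa only [smul_eq_mul, mul_comm] using this
      simp_rw [sub_mul]
      rw [integral_sub (i hl) (i hv0C.locallyIntegrable), ← hd φ hφ hφc,
        integral_mul_eq_integral_transpose hf hv0 hφ hφc, sub_self])
  refine ⟨fun x => Real.exp (-(2 * ϰ) * x) *
    (c.re + ∫ t in (0 : ℝ)..x, Real.exp ((2 * ϰ) * t) * f t),
    hasDerivAt_exp_mul_primitive (2 * ϰ) c.re hf, ?_⟩
  refine (hv'.re).ae_eq ?_
  filter_upwards [hc] with x hx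
  have hx' := congrArg Complex.re hx
  simp only [Complex.sub_re, Complex.ofReal_re, Complex.re_mul_ofReal] at hx'
  simp only [RCLike.re_to_complex]
  simp only [hv₀] at hx'
  linarith

/-- The `H⁻¹_ϰ` norm is invariant under reflection. -/
lemma sobolevNorm_comp_neg_le (s ϰ : ℝ) (f : ℝ → ℝ) :
    sobolevNorm s ϰ (fun x => f (-x)) ≤ sobolevNorm s ϰ f := by
  refine ENNReal.rpow_le_rpow (le_iInf₂ fun F hF => ?_) (by norm_num)
  have hmem : (fun ξ => F (-ξ)) ∈
      {F : ℝ → ℂ | Measurable F ∧ IsFourierTransform (fun x => (f (-x) : ℂ)) F} := by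
    refine ⟨hF.1.comp measurable_neg, fun φ hφ hc => ?_⟩
    have h1 : ContDiff ℝ ∞ fun x => φ (-x) := hφ.comp contDiff_neg
    have h2 : HasCompactSupport fun x => φ (-x) := hc.comp_homeomorph (Homeomorph.neg ℝ)
    have h3 := hF.2 _ h1 h2
    rw [← integral_neg_eq_self, ← integral_neg_eq_self (fun ξ => F (-ξ) * invFourier φ ξ)]
    simp only [neg_neg]
    rw [h3]
    refine integral_congr_ae (Filter.Eventually.of_forall fun ξ => ?_)
    simp only
    congr 1
    rw [invFourier, invFourier, ← integral_neg_eq_self]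
    simp
  refine (iInf₂_le _ hmem).trans ?_
  rw [← lintegral_neg_eq_self]
  simp

lemma sobolevNorm_comp_neg (s ϰ : ℝ) (f : ℝ → ℝ) :
    sobolevNorm s ϰ (fun x => f (-x)) = sobolevNorm s ϰ f := by
  refine le_antisymm (sobolevNorm_comp_neg_le s ϰ f) ?_
  simpa using sobolevNorm_comp_neg_le s ϰ (fun x => f (-x))

lemma sobolevNorm_neg_one_anti {ϰ₁ ϰ₂ : ℝ} (h0 : 0 < ϰ₁) (h : ϰ₁ ≤ ϰ₂) (f : ℝ → ℝ) :
    sobolevNorm (-1) ϰ₂ f ≤ sobolevNorm (-1) ϰ₁ f := by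
  refine ENNReal.rpow_le_rpow (iInf₂_mono fun F _ => lintegral_mono fun ξ => ?_) (by norm_num)
  gcongr ENNReal.ofReal ?_ * _
  rw [Real.rpow_neg_one, Real.rpow_neg_one]
  gcongr

/-! ### The causal solution operator of `v' + a v = h` -/

/-- The causal solution `x ↦ ∫_{y ≤ x} e^{-a(x-y)} h(y) dy` of `v' + a v = h`, with the factor
`e^{-ax}` taken out of the integral. -/
def causal (a : ℝ) (h : ℝ → ℝ) (x : ℝ) : ℝ :=
  Real.exp (-a * x) * ∫ y in Set.Iic x, Real.exp (a * y) * h y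

/-- The kernel `1_{t ≥ 0} e^{-at}` of `causal a`, with values in `[0, ∞]`. -/
def causalKernel (a t : ℝ) : ℝ≥0∞ :=
  (Set.Ici (0 : ℝ)).indicator (fun t => ENNReal.ofReal (Real.exp (-a * t))) t

@[fun_prop]
lemma measurable_causalKernel (a : ℝ) : Measurable (causalKernel a) :=
  (by fun_prop : Measurable fun t => ENNReal.ofReal (Real.exp (-a * t))).indicator
    measurableSet_Ici

lemma causalKernel_sq (a t : ℝ) : causalKernel a t ^ 2 = causalKernel (2 * a) t := by
  unfold causalKernel
  by_cases ht : t ∈ Set.Ici (0 : ℝ)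
  · rw [Set.indicator_of_mem ht, Set.indicator_of_mem ht, ← ENNReal.ofReal_pow (by positivity),
      ← Real.exp_nat_mul]
    congr 2
    push_cast
    ring
  · rw [Set.indicator_of_notMem ht, Set.indicator_of_notMem ht]
    simp

lemma lintegral_causalKernel {a : ℝ} (ha : 0 < a) :
    ∫⁻ t, causalKernel a t = ENNReal.ofReal (1 / a) := by
  unfold causalKernel
  rw [lintegral_indicator measurableSet_Ici, setLIntegral_congr Ioi_ae_eq_Ici.symm,
    ← ofReal_integral_eq_lintegral_ofReal (integrableOn_exp_mul_Ioi (by linarith) 0)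
      (Filter.Eventually.of_forall fun _ => (Real.exp_pos _).le),
    integral_exp_mul_Ioi (by linarith)]
  simp

/-- Tonelli's theorem for convolution with the causal kernel. -/
lemma lintegral_lintegral_causalKernel {a : ℝ} (ha : 0 < a) {g : ℝ → ℝ≥0∞} (hg : AEMeasurable g) :
    ∫⁻ x, ∫⁻ y, causalKernel a (x - y) * g y = ENNReal.ofReal (1 / a) * ∫⁻ y, g y := by
  rw [lintegral_lintegral_swap]
  · have e : ∀ y, ∫⁻ x, causalKernel a (x - y) * g y = ENNReal.ofReal (1 / a) * g y := by
      intro y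
      rw [lintegral_mul_const _ (by fun_prop),
        lintegral_sub_right_eq_self (fun x => causalKernel a x) y, lintegral_causalKernel ha]
    simp_rw [e]
    exact lintegral_const_mul' _ _ ENNReal.ofReal_ne_top
  · exact AEMeasurable.mul (by fun_prop) hg.comp_snd

lemma enorm_causal_le (a : ℝ) (h : ℝ → ℝ) (x : ℝ) :
    ‖causal a h x‖ₑ ≤ ∫⁻ y, causalKernel a (x - y) * ‖h y‖ₑ := by
  rw [causal, enorm_mul]
  refine (mul_le_mul_right (enorm_integral_le_lintegral_enorm _) _).trans ?_
  rw [← lintegral_const_mul' _ _ enorm_ne_top, ← lintegral_indicator measurableSet_Iic]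
  refine lintegral_mono fun y => ?_
  by_cases hy : y ≤ x
  · rw [Set.indicator_of_mem (by exact hy), causalKernel,
      Set.indicator_of_mem (by simpa using hy), enorm_mul, ← mul_assoc]
    gcongr
    rw [Real.enorm_of_nonneg (Real.exp_pos _).le, Real.enorm_of_nonneg (Real.exp_pos _).le,
      ← ENNReal.ofReal_mul (Real.exp_pos _).le, ← Real.exp_add]
    apply le_of_eq
    congr 2
    ring
  · rw [Set.indicator_of_notMem (by exact hy)]
    exact zero_le

lemma sq_lintegral_mul_le {f g : ℝ → ℝ≥0∞} (hf : AEMeasurable f) (hg : AEMeasurable g) :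
    (∫⁻ x, f x * g x) ^ 2 ≤ (∫⁻ x, f x ^ 2) * ∫⁻ x, g x ^ 2 := by
  have h := ENNReal.lintegral_mul_le_Lp_mul_Lq volume Real.HolderConjugate.two_two hf hg
  have h2 := pow_le_pow_left' h 2
  rw [mul_pow, ← ENNReal.rpow_natCast, ← ENNReal.rpow_natCast, ← ENNReal.rpow_natCast,
    ← ENNReal.rpow_mul, ← ENNReal.rpow_mul] at h2
  simpa using h2

/-- The `L¹ → L²` bound for the causal operator; the kernel has `L²` norm `(2a)^{-1/2}`. -/
lemma eLpNorm_causal_le_L1 {a C : ℝ} (ha : 0 < a) (hC : 0 ≤ C) (h1 : 1 ≤ 2 * a * C ^ 2)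
    {h : ℝ → ℝ} (hm : AEStronglyMeasurable h) :
    eLpNorm (causal a h) 2 volume ≤ ENNReal.ofReal C * eLpNorm h 1 volume := by
  rw [← ENNReal.pow_le_pow_left_iff (n := 2) (by norm_num), eLpNorm_two_sq, mul_pow,
    eLpNorm_one_eq_lintegral_enorm]
  have hhm : AEMeasurable (fun y => ‖h y‖ₑ) := hm.enorm
  have hs : ∀ y, ‖h y‖ₑ = (‖h y‖ₑ ^ (1 / 2 : ℝ)) ^ 2 := fun y => by
    rw [← ENNReal.rpow_natCast, ← ENNReal.rpow_mul]; norm_num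
  calc ∫⁻ x, ‖causal a h x‖ₑ ^ 2
      ≤ ∫⁻ x, (∫⁻ y, causalKernel (2 * a) (x - y) * ‖h y‖ₑ) * ∫⁻ y, ‖h y‖ₑ := by
        refine lintegral_mono fun x => ?_
        refine (pow_le_pow_left' (enorm_causal_le a h x) 2).trans ?_
        have e : ∀ y, causalKernel a (x - y) * ‖h y‖ₑ
            = (causalKernel a (x - y) * ‖h y‖ₑ ^ (1 / 2 : ℝ)) * ‖h y‖ₑ ^ (1 / 2 : ℝ) := fun y => by
          rw [mul_assoc, ← sq, ← hs]
        simp_rw [e]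
        refine (sq_lintegral_mul_le (by fun_prop) (by fun_prop)).trans (le_of_eq ?_)
        simp_rw [mul_pow, ← hs, causalKernel_sq]
    _ = ENNReal.ofReal (1 / (2 * a)) * (∫⁻ y, ‖h y‖ₑ) ^ 2 := by
        rw [lintegral_mul_const'', lintegral_lintegral_causalKernel (by positivity) hhm]
        · ring
        · exact AEMeasurable.lintegral_prod_right'
            (f := fun p : ℝ × ℝ => causalKernel (2 * a) (p.1 - p.2) * ‖h p.2‖ₑ)
            (AEMeasurable.mul (by fun_prop) hhm.comp_snd)
    _ ≤ ENNReal.ofReal C ^ 2 * (∫⁻ y, ‖h y‖ₑ) ^ 2 := by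
        gcongr
        rw [← ENNReal.ofReal_pow hC]
        apply ENNReal.ofReal_le_ofReal
        rw [div_le_iff₀ (by positivity)]
        linarith

/-- The `L² → L²` bound for the causal operator; the kernel has `L¹` norm `1 / a`. -/
lemma eLpNorm_causal_le_L2 {a : ℝ} (ha : 0 < a) {h : ℝ → ℝ} (hm : AEStronglyMeasurable h) :
    eLpNorm (causal a h) 2 volume ≤ ENNReal.ofReal (1 / a) * eLpNorm h 2 volume := by
  rw [← ENNReal.pow_le_pow_left_iff (n := 2) (by norm_num), mul_pow, eLpNorm_two_sq,
    eLpNorm_two_sq]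
  have hhm : AEMeasurable (fun y => ‖h y‖ₑ) := hm.enorm
  have hs : ∀ t, causalKernel a t = causalKernel (a / 2) t ^ 2 := fun y => by
    rw [causalKernel_sq]; congr 1; ring
  calc ∫⁻ x, ‖causal a h x‖ₑ ^ 2
      ≤ ∫⁻ x, ENNReal.ofReal (1 / a) * ∫⁻ y, causalKernel a (x - y) * ‖h y‖ₑ ^ 2 := by
        refine lintegral_mono fun x => ?_
        refine (pow_le_pow_left' (enorm_causal_le a h x) 2).trans ?_
        have e : ∀ y, causalKernel a (x - y) * ‖h y‖ₑ
            = causalKernel (a / 2) (x - y) * (causalKernel (a / 2) (x - y) * ‖h y‖ₑ) := fun y => by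
          rw [← mul_assoc, ← sq, ← hs]
        simp_rw [e]
        refine (sq_lintegral_mul_le (by fun_prop) (by fun_prop)).trans (le_of_eq ?_)
        simp_rw [mul_pow, ← hs]
        rw [lintegral_sub_left_eq_self (fun y => causalKernel a y) x, lintegral_causalKernel ha]
    _ = ENNReal.ofReal (1 / a) ^ 2 * ∫⁻ y, ‖h y‖ₑ ^ 2 := by
        rw [lintegral_const_mul' _ _ ENNReal.ofReal_ne_top,
          lintegral_lintegral_causalKernel ha (hhm.pow_const 2)]
        ring

lemma integrableOn_exp_mul_of_integrable {a : ℝ} (ha : 0 < a) {h : ℝ → ℝ} (hh : Integrable h)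
    (x : ℝ) : IntegrableOn (fun y => Real.exp (a * y) * h y) (Set.Iic x) := by
  refine Integrable.bdd_mul (c := Real.exp (a * x)) hh.integrableOn
    (Continuous.aestronglyMeasurable (by fun_prop)) ?_
  filter_upwards [ae_restrict_mem measurableSet_Iic] with y hy
  rw [Real.norm_of_nonneg (Real.exp_pos _).le, Real.exp_le_exp]
  exact mul_le_mul_of_nonneg_left hy ha.le

lemma integrableOn_exp_mul_of_memLp_two {a : ℝ} (ha : 0 < a) {h : ℝ → ℝ} (hh : MemLp h 2 volume)
    (x : ℝ) : IntegrableOn (fun y => Real.exp (a * y) * h y) (Set.Iic x) := by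
  have h1 : MemLp (fun y => Real.exp (a * y)) 2 (volume.restrict (Set.Iic x)) := by
    refine (memLp_two_iff_integrable_sq (Continuous.aestronglyMeasurable (by fun_prop))).2 ?_
    have := integrableOn_exp_mul_Iic (a := 2 * a) (by positivity) x
    refine this.congr (Filter.Eventually.of_forall fun y => ?_)
    simp only [← Real.exp_nat_mul]
    congr 1
    push_cast
    ring
  exact h1.integrable_mul (hh.restrict _)

lemma setIntegral_Iic_eq {f : ℝ → ℝ} (hf : ∀ x, IntegrableOn f (Set.Iic x)) :
    (fun x => ∫ y in Set.Iic x, f y)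
      = fun x => (∫ y in Set.Iic 0, f y) + ∫ y in (0 : ℝ)..x, f y := by
  ext x
  rw [← intervalIntegral.integral_Iic_sub_Iic (hf 0) (hf x)]
  ring

lemma continuous_causal {a : ℝ} {h : ℝ → ℝ}
    (hi : ∀ x, IntegrableOn (fun y => Real.exp (a * y) * h y) (Set.Iic x)) :
    Continuous (causal a h) := by
  have h1 : Continuous fun x => ∫ y in Set.Iic x, Real.exp (a * y) * h y := by
    rw [setIntegral_Iic_eq hi]
    refine continuous_const.add (intervalIntegral.continuous_primitive (fun b c => ?_) 0)
    rw [intervalIntegrable_iff]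
    exact (hi (max b c)).mono_set fun y hy => hy.2
  exact (by fun_prop : Continuous fun x => Real.exp (-a * x)).mul h1

lemma hasDerivAt_causal {a : ℝ} {h : ℝ → ℝ} (hh : Continuous h)
    (hi : ∀ x, IntegrableOn (fun y => Real.exp (a * y) * h y) (Set.Iic x)) (x : ℝ) :
    HasDerivAt (causal a h) (h x - a * causal a h x) x := by
  have h1 := hasDerivAt_exp_mul_primitive a (∫ y in Set.Iic 0, Real.exp (a * y) * h y) hh x
  have e : causal a h = fun x => Real.exp (-a * x) * ((∫ y in Set.Iic 0, Real.exp (a * y) * h y)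
      + ∫ t in (0 : ℝ)..x, Real.exp (a * t) * h t) := by
    ext x
    rw [causal]
    congr 1
    exact congrFun (setIntegral_Iic_eq hi) x
  rw [e]
  exact h1

lemma causal_add {a : ℝ} {h k : ℝ → ℝ}
    (hi : ∀ x, IntegrableOn (fun y => Real.exp (a * y) * h y) (Set.Iic x))
    (ki : ∀ x, IntegrableOn (fun y => Real.exp (a * y) * k y) (Set.Iic x)) (x : ℝ) :
    causal a (fun y => h y + k y) x = causal a h x + causal a k x := by
  simp_rw [causal, mul_add (Real.exp (a * _))]
  rw [integral_add (hi x) (ki x)]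
  ring

lemma causal_sub {a : ℝ} {h k : ℝ → ℝ}
    (hi : ∀ x, IntegrableOn (fun y => Real.exp (a * y) * h y) (Set.Iic x))
    (ki : ∀ x, IntegrableOn (fun y => Real.exp (a * y) * k y) (Set.Iic x)) (x : ℝ) :
    causal a (fun y => h y - k y) x = causal a h x - causal a k x := by
  simp_rw [causal, mul_sub (Real.exp (a * _))]
  rw [integral_sub (hi x) (ki x)]
  ring

lemma causal_congr_ae {a : ℝ} {h k : ℝ → ℝ} (e : h =ᵐ[volume] k) : causal a h = causal a k := by
  ext x
  rw [causal, causal]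
  congr 1
  refine integral_congr_ae (ae_restrict_of_ae ?_)
  filter_upwards [e] with y hy
  rw [hy]

lemma abs_causal_le {a : ℝ} (ha : 0 < a) {h : ℝ → ℝ} (hh : Integrable h) (x : ℝ) :
    |causal a h x| ≤ ∫ y, |h y| := by
  rw [causal, abs_mul, abs_of_pos (Real.exp_pos _)]
  have h1 : |∫ y in Set.Iic x, Real.exp (a * y) * h y| ≤ Real.exp (a * x) * ∫ y, |h y| := by
    refine (abs_integral_le_integral_abs).trans ?_
    rw [← integral_const_mul]
    refine (setIntegral_mono_on (integrableOn_exp_mul_of_integrable ha hh x).abs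
      (hh.abs.const_mul _).integrableOn measurableSet_Iic ?_).trans
      (setIntegral_le_integral (hh.abs.const_mul _)
        (Filter.Eventually.of_forall fun y => by positivity))
    intro y hy
    rw [abs_mul, abs_of_pos (Real.exp_pos _)]
    gcongr
    exact hy
  calc Real.exp (-a * x) * |∫ y in Set.Iic x, Real.exp (a * y) * h y|
      ≤ Real.exp (-a * x) * (Real.exp (a * x) * ∫ y, |h y|) := by gcongr
    _ = ∫ y, |h y| := by rw [← mul_assoc, ← Real.exp_add]; simp

/-- A solution of `d' + a d = r` in `L²` is the causal one, because the homogeneous solution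
`e^{-ax}` is not in `L²`. -/
lemma eq_causal_of_memLp {a : ℝ} (ha : 0 < a) {d r : ℝ → ℝ} (hr : Continuous r)
    (hi : ∀ x, IntegrableOn (fun y => Real.exp (a * y) * r y) (Set.Iic x))
    (hd : ∀ x, HasDerivAt d (r x - a * d x) x) (hd2 : MemLp d 2 volume)
    (hc2 : MemLp (causal a r) 2 volume) : d = causal a r := by
  have h1 : ∀ x, HasDerivAt (fun x => Real.exp (a * x) * (d x - causal a r x)) 0 x := by
    intro x
    have h0 : HasDerivAt (fun x : ℝ => a * x) a x := by
      simpa using (hasDerivAt_id x).const_mul a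
    convert! h0.exp.mul ((hd x).sub (hasDerivAt_causal hr hi x)) using 1
    simp only [Pi.sub_apply]
    ring
  have h2 : ∀ x, d x - causal a r x = (d 0 - causal a r 0) * Real.exp (-a * x) := by
    intro x
    have := is_const_of_deriv_eq_zero (fun x => (h1 x).differentiableAt) (fun x => (h1 x).deriv) x 0
    simp only [mul_zero, Real.exp_zero, one_mul] at this
    rw [← this, mul_comm, ← mul_assoc, ← Real.exp_add]
    simp
  have h3 := eq_zero_of_exp_memLp ha (c := ((d 0 - causal a r 0 : ℝ) : ℂ)) (hd2.sub hc2).ofReal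
    (Filter.Eventually.of_forall fun x => by
      rw [← Complex.ofReal_mul, ← h2 x]; rfl)
  have h4 : d 0 - causal a r 0 = 0 := by exact_mod_cast h3
  ext x
  have := h2 x
  rw [h4, zero_mul] at this
  linarith

/-- The `L²` bound for a solution of `d' + a d = r₁ + r₂` with `r₁ ∈ L¹` and `r₂ ∈ L²`. -/
lemma eLpNorm_le_of_hasDerivAt {a C : ℝ} (ha : 0 < a) (hC : 0 ≤ C) (h1 : 1 ≤ 2 * a * C ^ 2)
    {d r₁ r₂ : ℝ → ℝ} (hr₁ : Continuous r₁) (hr₂ : Continuous r₂) (h₁ : MemLp r₁ 1 volume)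
    (h₂ : MemLp r₂ 2 volume) (hd : ∀ x, HasDerivAt d (r₁ x + r₂ x - a * d x) x)
    (hd2 : MemLp d 2 volume) :
    eLpNorm d 2 volume
      ≤ ENNReal.ofReal C * eLpNorm r₁ 1 volume + ENNReal.ofReal (1 / a) * eLpNorm r₂ 2 volume := by
  have i₁ := integrableOn_exp_mul_of_integrable ha (memLp_one_iff_integrable.1 h₁)
  have i₂ := integrableOn_exp_mul_of_memLp_two ha h₂
  have b₁ := eLpNorm_causal_le_L1 ha hC h1 hr₁.aestronglyMeasurable
  have b₂ := eLpNorm_causal_le_L2 ha hr₂.aestronglyMeasurable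
  have m₁ : MemLp (causal a r₁) 2 volume := ⟨(continuous_causal i₁).aestronglyMeasurable,
    b₁.trans_lt (ENNReal.mul_lt_top ENNReal.ofReal_lt_top h₁.2)⟩
  have m₂ : MemLp (causal a r₂) 2 volume := ⟨(continuous_causal i₂).aestronglyMeasurable,
    b₂.trans_lt (ENNReal.mul_lt_top ENNReal.ofReal_lt_top h₂.2)⟩
  have e : causal a (fun y => r₁ y + r₂ y) = causal a r₁ + causal a r₂ :=
    funext fun x => causal_add i₁ i₂ x
  have ii : ∀ x, IntegrableOn (fun y => Real.exp (a * y) * (r₁ y + r₂ y)) (Set.Iic x) := by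
    intro x
    simp only [mul_add]
    exact (i₁ x).add (i₂ x)
  have hde := eq_causal_of_memLp (r := fun y => r₁ y + r₂ y) ha (hr₁.add hr₂) ii hd hd2
    (by rw [e]; exact m₁.add m₂)
  rw [hde, e]
  exact (eLpNorm_add_le m₁.1 m₂.1 (by norm_num)).trans (add_le_add b₁ b₂)

/-! ### The Riccati equation -/

lemma eLpNorm_one_mul_le {u v : ℝ → ℝ} (hu : AEStronglyMeasurable u)
    (hv : AEStronglyMeasurable v) :
    eLpNorm (fun x => u x * v x) 1 volume ≤ eLpNorm u 2 volume * eLpNorm v 2 volume := by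
  rw [← ENNReal.pow_le_pow_left_iff (n := 2) (by norm_num), mul_pow, eLpNorm_two_sq,
    eLpNorm_two_sq, eLpNorm_one_eq_lintegral_enorm]
  simp_rw [enorm_mul]
  exact sq_lintegral_mul_le hu.enorm hv.enorm

/-- A solution `u ∈ L²` of `u' + a u + u² = q` that is small in `L²`, for a coefficient `q` whose
causal solution is small in `L²`. It is found as the fixed point of `u ↦ causal q - causal u²`,
which is a contraction of the ball of radius `1 / 5` by the `L¹ → L²` bound. -/
lemma exists_riccati {a : ℝ} (ha : 200 ≤ a) {q : ℝ → ℝ} (hq : Continuous q) (hqi : Integrable q)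
    (hφ : MemLp (causal a q) 2 volume)
    (hφn : eLpNorm (causal a q) 2 volume ≤ ENNReal.ofReal (1 / 10)) :
    ∃ u : ℝ → ℝ, (∀ x, HasDerivAt u (q x - u x ^ 2 - a * u x) x) ∧
      (∀ x, u x = causal a q x - causal a (fun y => u y ^ 2) x) ∧
      MemLp u 2 volume ∧ eLpNorm u 2 volume ≤ ENNReal.ofReal (1 / 5) := by
  have ha0 : 0 < a := by linarith
  have hC : (1 : ℝ) ≤ 2 * a * (1 / 20) ^ 2 := by linarith
  -- the polarized quadratic term is a bounded bilinear map from `L² × L²` to `L²`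
  have hmul : ∀ {u v : ℝ → ℝ}, MemLp u 2 volume → MemLp v 2 volume →
      MemLp (causal a fun y => u y * v y) 2 volume ∧
      eLpNorm (causal a fun y => u y * v y) 2 volume
        ≤ ENNReal.ofReal (1 / 20) * (eLpNorm u 2 volume * eLpNorm v 2 volume) := by
    intro u v hu hv
    have hb : eLpNorm (causal a fun y => u y * v y) 2 volume
        ≤ ENNReal.ofReal (1 / 20) * (eLpNorm u 2 volume * eLpNorm v 2 volume) :=
      (eLpNorm_causal_le_L1 ha0 (by norm_num) hC (hu.1.mul hv.1)).trans
        (by gcongr; exact eLpNorm_one_mul_le hu.1 hv.1)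
    refine ⟨⟨(continuous_causal (integrableOn_exp_mul_of_integrable ha0
      (hu.integrable_mul hv))).aestronglyMeasurable, hb.trans_lt ?_⟩, hb⟩
    exact ENNReal.mul_lt_top ENNReal.ofReal_lt_top (ENNReal.mul_lt_top hu.2 hv.2)
  have hT : ∀ u : Lp ℝ 2 (volume : Measure ℝ),
      MemLp (fun x => causal a q x - causal a (fun y => u y * u y) x) 2 volume :=
    fun u => hφ.sub (hmul (Lp.memLp u) (Lp.memLp u)).1
  let T : Lp ℝ 2 (volume : Measure ℝ) → Lp ℝ 2 (volume : Measure ℝ) := fun u => (hT u).toLp _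
  let s : Set (Lp ℝ 2 (volume : Measure ℝ)) := Metric.closedBall 0 (1 / 5)
  have hs : ∀ u : Lp ℝ 2 (volume : Measure ℝ), u ∈ s ↔
      eLpNorm u 2 volume ≤ ENNReal.ofReal (1 / 5) := by
    intro u
    rw [mem_closedBall_zero_iff, Lp.norm_def,
      ENNReal.le_ofReal_iff_toReal_le (Lp.memLp u).2.ne (by norm_num)]
  have hmaps : Set.MapsTo T s s := by
    intro u hu
    rw [hs] at hu ⊢
    rw [eLpNorm_congr_ae (hT u).coeFn_toLp]
    refine (eLpNorm_sub_le hφ.1 (hmul (Lp.memLp u) (Lp.memLp u)).1.1 (by norm_num)).trans ?_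
    refine (add_le_add hφn ((hmul (Lp.memLp u) (Lp.memLp u)).2.trans
      (mul_le_mul_right (mul_le_mul' hu hu) _))).trans ?_
    rw [← ENNReal.ofReal_mul (by norm_num), ← ENNReal.ofReal_mul (by norm_num),
      ← ENNReal.ofReal_add (by norm_num) (by norm_num)]
    exact ENNReal.ofReal_le_ofReal (by norm_num)
  have hcon : ContractingWith (1 / 2) (hmaps.restrict T s s) := by
    refine ⟨by rw [← NNReal.coe_lt_coe]; norm_num, fun u v => ?_⟩
    obtain ⟨u, hu⟩ := u
    obtain ⟨v, hv⟩ := v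
    rw [hs] at hu hv
    change edist (T u) (T v) ≤ ((1 / 2 : NNReal) : ℝ≥0∞) * edist u v
    have iu := integrableOn_exp_mul_of_integrable ha0 ((Lp.memLp u).integrable_mul (Lp.memLp u))
    have iv := integrableOn_exp_mul_of_integrable ha0 ((Lp.memLp v).integrable_mul (Lp.memLp v))
    rw [Lp.edist_toLp_toLp, Lp.edist_def]
    have e : (fun x => causal a q x - causal a (fun y => u y * u y) x)
        - (fun x => causal a q x - causal a (fun y => v y * v y) x)
        = causal a (fun y => (v - u : ℝ → ℝ) y * (v + u : ℝ → ℝ) y) := by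
      ext x
      have h1 := causal_sub (h := fun y => v y * v y) (k := fun y => u y * u y) iv iu x
      simp only [Pi.sub_apply]
      rw [sub_sub_sub_cancel_left, ← h1]
      congr 2
      ext y
      simp only [Pi.add_apply]
      ring
    rw [e]
    refine (hmul ((Lp.memLp v).sub (Lp.memLp u)) ((Lp.memLp v).add (Lp.memLp u))).2.trans ?_
    have h2 : eLpNorm (v + u : ℝ → ℝ) 2 volume ≤ ENNReal.ofReal (2 / 5) := by
      refine (eLpNorm_add_le (Lp.memLp v).1 (Lp.memLp u).1 (by norm_num)).trans
        ((add_le_add hv hu).trans ?_)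
      rw [← ENNReal.ofReal_add (by norm_num) (by norm_num)]
      exact ENNReal.ofReal_le_ofReal (by norm_num)
    rw [eLpNorm_sub_comm]
    calc ENNReal.ofReal (1 / 20) * (eLpNorm (u - v : ℝ → ℝ) 2 volume
          * eLpNorm (v + u : ℝ → ℝ) 2 volume)
        ≤ ENNReal.ofReal (1 / 20) * (eLpNorm (u - v : ℝ → ℝ) 2 volume
          * ENNReal.ofReal (2 / 5)) := by
          gcongr
      _ = ENNReal.ofReal (1 / 50) * eLpNorm (u - v : ℝ → ℝ) 2 volume := by
          rw [mul_comm (eLpNorm _ _ _), ← mul_assoc, ← ENNReal.ofReal_mul (by norm_num)]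
          norm_num
      _ ≤ _ := by
          gcongr
          rw [ENNReal.ofReal, ENNReal.coe_le_coe, ← NNReal.coe_le_coe]
          rw [Real.coe_toNNReal _ (by norm_num)]
          norm_num
  obtain ⟨u₀, hu₀, hfix, -⟩ := ContractingWith.exists_fixedPoint'
    (Metric.isClosed_closedBall.isComplete) hmaps hcon
    (x := 0) (by simp [s]) (edist_ne_top _ _)
  have hae : (u₀ : ℝ → ℝ) =ᵐ[volume] fun x => causal a q x - causal a (fun y => u₀ y * u₀ y) x := by
    have h1 := (hT u₀).coeFn_toLp
    have h2 : (hT u₀).toLp _ = u₀ := hfix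
    rwa [h2] at h1
  -- the right-hand side is the continuous representative
  set u : ℝ → ℝ := fun x => causal a q x - causal a (fun y => u₀ y * u₀ y) x with hu
  have hsq : causal a (fun y => u₀ y * u₀ y) = causal a (fun y => u y ^ 2) := by
    refine causal_congr_ae ?_
    filter_upwards [hae] with y hy
    rw [hy, sq]
  have hueq : ∀ x, u x = causal a q x - causal a (fun y => u y ^ 2) x := fun x => by
    rw [← hsq]
  have hum : MemLp u 2 volume := hT u₀
  have hui : Integrable fun y => u y ^ 2 := hum.integrable_sq
  have iq := integrableOn_exp_mul_of_integrable ha0 hqi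
  have iu := integrableOn_exp_mul_of_integrable ha0 hui
  have huc : Continuous u := by
    rw [funext hueq]
    exact (continuous_causal iq).sub (continuous_causal iu)
  refine ⟨u, fun x => ?_, hueq, hum, ?_⟩
  · have h1 := (hasDerivAt_causal hq iq x).sub
      (hasDerivAt_causal (h := fun y => u y ^ 2) (huc.pow 2) iu x)
    have h2 : u = causal a q - causal a (fun y => u y ^ 2) := funext hueq
    rw [← h2] at h1
    convert! h1 using 1
    rw [hueq x]
    ring
  · rw [← eLpNorm_congr_ae hae]
    exact (hs u₀).1 hu₀

/-! ### Weighted comparison of the Riccati solution with the `H⁻¹` norm -/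

lemma le_mul_of_le_mul_add_mul {x n : ℝ≥0∞} (hx : x ≠ ⊤) (hn : n ≠ ⊤) {α β c : ℝ} (hα : 0 ≤ α)
    (hβ : 0 ≤ β) (hα1 : α < 1) (hc : β ≤ c * (1 - α))
    (h : x ≤ ENNReal.ofReal α * x + ENNReal.ofReal β * n) : x ≤ ENNReal.ofReal c * n := by
  have hc0 : 0 ≤ c := by
    by_contra hneg
    nlinarith
  lift x to NNReal using hx
  lift n to NNReal using hn
  simp only [ENNReal.ofReal] at h ⊢
  rw [← ENNReal.coe_mul, ← ENNReal.coe_mul, ← ENNReal.coe_add, ENNReal.coe_le_coe,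
    ← NNReal.coe_le_coe] at h
  rw [← ENNReal.coe_mul, ENNReal.coe_le_coe, ← NNReal.coe_le_coe]
  push_cast at h ⊢
  rw [Real.coe_toNNReal _ hα, Real.coe_toNNReal _ hβ] at h
  rw [Real.coe_toNNReal _ hc0]
  have h1 : (1 - α) * x ≤ (1 - α) * (c * n) := by
    nlinarith [mul_le_mul_of_nonneg_right hc n.2, n.2]
  exact le_of_mul_le_mul_left h1 (by linarith)

lemma sobolevNorm_le_of_riccati {ϰ : ℝ} (hϰ : 100 ≤ ϰ) {q u w : ℝ → ℝ} (hq : Continuous q)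
    (hu : ∀ x, HasDerivAt u (q x - u x ^ 2 - 2 * ϰ * u x) x) (hu2 : MemLp u 2 volume)
    (hun : eLpNorm u 2 volume ≤ ENNReal.ofReal (1 / 5))
    (hw : Differentiable ℝ w) (hw' : Continuous (deriv w)) (hww : ∀ x, |deriv w x| ≤ |w x|) :
    sobolevNorm (-1) ϰ (fun x => w x * q x)
      ≤ ENNReal.ofReal (103 / 100) * eLpNorm (fun x => w x * u x) 2 volume := by
  have huc : Continuous u := continuous_iff_continuousAt.2 fun x => (hu x).continuousAt
  have hwc := hw.continuous
  by_cases hA : eLpNorm (fun x => w x * u x) 2 volume = ⊤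
  · rw [hA, ENNReal.mul_top (by norm_num)]; exact le_top
  have ha0 : 0 < 2 * ϰ := by linarith
  have hC : (1 : ℝ) ≤ 2 * (2 * ϰ) * (1 / 20) ^ 2 := by linarith
  have hwu : MemLp (fun x => w x * u x) 2 volume :=
    ⟨(hwc.mul huc).aestronglyMeasurable, lt_top_iff_ne_top.2 hA⟩
  have hw'n : ∀ x, ‖deriv w x * u x‖ ≤ ‖w x * u x‖ := fun x => by
    rw [norm_mul, norm_mul, Real.norm_eq_abs, Real.norm_eq_abs (w x)]
    exact mul_le_mul_of_nonneg_right (hww x) (norm_nonneg _)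
  have hw'u : MemLp (fun x => deriv w x * u x) 2 volume :=
    hwu.mono (hw'.mul huc).aestronglyMeasurable (Filter.Eventually.of_forall hw'n)
  have i₁ := integrableOn_exp_mul_of_integrable ha0 (hwu.integrable_mul hu2)
  have i₂ := integrableOn_exp_mul_of_memLp_two ha0 hw'u
  have b₁ : eLpNorm (causal (2 * ϰ) fun x => w x * u x * u x) 2 volume
      ≤ ENNReal.ofReal (1 / 100) * eLpNorm (fun x => w x * u x) 2 volume := by
    refine (eLpNorm_causal_le_L1 ha0 (by norm_num) hC
      ((hwc.mul huc).mul huc).aestronglyMeasurable).trans ?_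
    refine (mul_le_mul_right (eLpNorm_one_mul_le hwu.1 hu2.1) _).trans ?_
    refine (mul_le_mul_right (mul_le_mul_right hun _) _).trans (le_of_eq ?_)
    rw [mul_comm (eLpNorm _ _ _), ← mul_assoc, ← ENNReal.ofReal_mul (by norm_num)]
    norm_num
  have b₂ : eLpNorm (causal (2 * ϰ) fun x => deriv w x * u x) 2 volume
      ≤ ENNReal.ofReal (1 / 100) * eLpNorm (fun x => w x * u x) 2 volume := by
    refine (eLpNorm_causal_le_L2 ha0 (hw'.mul huc).aestronglyMeasurable).trans ?_
    refine mul_le_mul' (ENNReal.ofReal_le_ofReal ?_) (eLpNorm_mono hw'n)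
    exact one_div_le_one_div_of_le (by norm_num) (by linarith)
  have m₁ : MemLp (causal (2 * ϰ) fun x => w x * u x * u x) 2 volume :=
    ⟨(continuous_causal i₁).aestronglyMeasurable,
      b₁.trans_lt (ENNReal.mul_lt_top ENNReal.ofReal_lt_top hwu.2)⟩
  have m₂ : MemLp (causal (2 * ϰ) fun x => deriv w x * u x) 2 volume :=
    ⟨(continuous_causal i₂).aestronglyMeasurable,
      b₂.trans_lt (ENNReal.mul_lt_top ENNReal.ofReal_lt_top hwu.2)⟩
  -- `w u` misses the equation `v' + 2ϰ v = w q` by `-w u² + w' u`, which the causal terms correct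
  have hv : ∀ x, HasDerivAt ((fun x => w x * u x) + ((causal (2 * ϰ) fun x => w x * u x * u x)
      - causal (2 * ϰ) fun x => deriv w x * u x))
      (w x * q x - 2 * ϰ * ((fun x => w x * u x) + ((causal (2 * ϰ) fun x => w x * u x * u x)
      - causal (2 * ϰ) fun x => deriv w x * u x)) x) x := by
    intro x
    have h1 := ((hw x).hasDerivAt.mul (hu x)).add
      ((hasDerivAt_causal (h := fun x => w x * u x * u x) ((hwc.mul huc).mul huc) i₁ x).sub
      (hasDerivAt_causal (h := fun x => deriv w x * u x) (hw'.mul huc) i₂ x))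
    convert! h1 using 1
    simp only [Pi.add_apply, Pi.sub_apply]
    ring
  rw [sobolevNorm_eq_eLpNorm (f := fun x => w x * q x) (by linarith) (hwc.mul hq) hv
    (hwu.add (m₁.sub m₂))]
  refine (eLpNorm_add_le hwu.1 (m₁.sub m₂).1 (by norm_num)).trans ?_
  refine (add_le_add le_rfl ((eLpNorm_sub_le m₁.1 m₂.1 (by norm_num)).trans
    (add_le_add b₁ b₂))).trans ?_
  nth_rewrite 1 [← one_mul (eLpNorm (fun x => w x * u x) 2 volume)]
  rw [← add_mul, ← add_mul]
  gcongr
  rw [← ENNReal.ofReal_one, ← ENNReal.ofReal_add (by norm_num) (by norm_num),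
    ← ENNReal.ofReal_add (by norm_num) (by norm_num)]
  exact ENNReal.ofReal_le_ofReal (by norm_num)

/-- The a priori bound. Since `w u` is not known to be in `L²`, the weight `w` is first
replaced by the bounded weight `w / (1 + ε w)`, for which the bound is uniform in `ε`. -/
lemma eLpNorm_le_sobolevNorm_of_riccati {ϰ : ℝ} (hϰ : 100 ≤ ϰ) {q u w : ℝ → ℝ}
    (hq : Continuous q) (hu : ∀ x, HasDerivAt u (q x - u x ^ 2 - 2 * ϰ * u x) x)
    (hu2 : MemLp u 2 volume) (hun : eLpNorm u 2 volume ≤ ENNReal.ofReal (1 / 5))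
    (hw : Differentiable ℝ w) (hw' : Continuous (deriv w)) (hw0 : ∀ x, 0 < w x)
    (hww : ∀ x, |deriv w x| ≤ w x) :
    eLpNorm (fun x => w x * u x) 2 volume
      ≤ ENNReal.ofReal (103 / 100) * sobolevNorm (-1) ϰ (fun x => w x * q x) := by
  have huc : Continuous u := continuous_iff_continuousAt.2 fun x => (hu x).continuousAt
  have hwc := hw.continuous
  by_cases hN : sobolevNorm (-1) ϰ (fun x => w x * q x) = ⊤
  · rw [hN, ENNReal.mul_top (by norm_num)]; exact le_top
  have ha0 : 0 < 2 * ϰ := by linarith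
  have hC : (1 : ℝ) ≤ 2 * (2 * ϰ) * (1 / 20) ^ 2 := by linarith
  obtain ⟨v, hv, hv2⟩ := exists_memLp_of_sobolevNorm_ne_top (f := fun x => w x * q x)
    (by linarith) (hwc.mul hq) hN
  rw [sobolevNorm_eq_eLpNorm (f := fun x => w x * q x) (by linarith) (hwc.mul hq) hv hv2]
  have hvc : Continuous v := continuous_iff_continuousAt.2 fun x => (hv x).continuousAt
  have key : ∀ ε : ℝ, 0 < ε → eLpNorm (fun x => w x / (1 + ε * w x) * u x) 2 volume
      ≤ ENNReal.ofReal (103 / 100) * eLpNorm v 2 volume := by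
    intro ε hε
    have hp : ∀ x, 0 < 1 + ε * w x := fun x => by have := hw0 x; positivity
    have hpne : ∀ x, 1 + ε * w x ≠ 0 := fun x => (hp x).ne'
    have hd1 : ∀ x, HasDerivAt (fun x => 1 + ε * w x) (ε * deriv w x) x :=
      fun x => ((hw x).hasDerivAt.const_mul ε).const_add 1
    have hθ : ∀ x, HasDerivAt (fun x => (1 + ε * w x)⁻¹)
        (-(ε * deriv w x) / (1 + ε * w x) ^ 2) x := fun x => (hd1 x).inv (hpne x)
    have hW : ∀ x, HasDerivAt (fun x => w x / (1 + ε * w x))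
        (deriv w x / (1 + ε * w x) ^ 2) x := fun x => by
      convert! (hw x).hasDerivAt.div (hd1 x) (hpne x) using 1
      ring
    have hc1 : Continuous fun x => 1 + ε * w x := by fun_prop
    have hWc : Continuous fun x => w x / (1 + ε * w x) := hwc.div hc1 hpne
    have hWu : MemLp (fun x => w x / (1 + ε * w x) * u x) 2 volume := by
      refine hu2.of_le_mul (c := ε⁻¹) (hWc.mul huc).aestronglyMeasurable
        (Filter.Eventually.of_forall fun x => ?_)
      rw [norm_mul, Real.norm_of_nonneg (div_pos (hw0 x) (hp x)).le]
      gcongr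
      rw [div_le_iff₀ (hp x)]
      have : ε⁻¹ * (1 + ε * w x) = ε⁻¹ + w x := by field_simp
      rw [this]
      have := inv_pos.2 hε
      linarith
    set A := eLpNorm (fun x => w x / (1 + ε * w x) * u x) 2 volume with hA
    have hsq : ∀ x, 1 + ε * w x ≤ (1 + ε * w x) ^ 2 := fun x => by
      have := mul_pos hε (hw0 x)
      nlinarith
    have nθ : ∀ x, ‖(1 + ε * w x)⁻¹ * v x‖ ≤ ‖v x‖ := fun x => by
      rw [norm_mul, Real.norm_of_nonneg (inv_pos.2 (hp x)).le]
      refine mul_le_of_le_one_left (norm_nonneg _) (inv_le_one_of_one_le₀ ?_)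
      have := mul_pos hε (hw0 x)
      linarith
    have mθ : MemLp (fun x => (1 + ε * w x)⁻¹ * v x) 2 volume :=
      hv2.mono ((hc1.inv₀ hpne).mul hvc).aestronglyMeasurable (Filter.Eventually.of_forall nθ)
    have n₁ : ∀ x, ‖deriv w x / (1 + ε * w x) ^ 2 * u x‖ ≤ ‖w x / (1 + ε * w x) * u x‖ :=
        fun x => by
      rw [norm_mul, norm_mul, Real.norm_of_nonneg (div_pos (hw0 x) (hp x)).le, norm_div,
        Real.norm_of_nonneg (sq_nonneg (1 + ε * w x)), Real.norm_eq_abs]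
      gcongr
      · exact (hw0 x).le
      · exact hp x
      · exact hww x
      · exact hsq x
    have n₂ : ∀ x, ‖-(ε * deriv w x) / (1 + ε * w x) ^ 2 * v x‖ ≤ ‖v x‖ := fun x => by
      rw [norm_mul]
      refine mul_le_of_le_one_left (norm_nonneg _) ?_
      rw [norm_div, Real.norm_of_nonneg (sq_nonneg (1 + ε * w x)), norm_neg, norm_mul,
        Real.norm_of_nonneg hε.le, Real.norm_eq_abs, div_le_one (by have := hp x; positivity)]
      have := mul_le_mul_of_nonneg_left (hww x) hε.le
      linarith [hsq x]
    have c₁ : Continuous fun x => deriv w x / (1 + ε * w x) ^ 2 * u x :=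
      (hw'.div (hc1.pow 2) fun x => pow_ne_zero 2 (hpne x)).mul huc
    have c₂ : Continuous fun x => -(ε * deriv w x) / (1 + ε * w x) ^ 2 * v x :=
      ((continuous_const.mul hw').neg.div (hc1.pow 2) fun x => pow_ne_zero 2 (hpne x)).mul hvc
    have m₁ : MemLp (fun x => deriv w x / (1 + ε * w x) ^ 2 * u x) 2 volume :=
      hWu.mono c₁.aestronglyMeasurable (Filter.Eventually.of_forall n₁)
    have m₂ : MemLp (fun x => -(ε * deriv w x) / (1 + ε * w x) ^ 2 * v x) 2 volume :=
      hv2.mono c₂.aestronglyMeasurable (Filter.Eventually.of_forall n₂)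
    have hd : ∀ x, HasDerivAt
        (fun x => w x / (1 + ε * w x) * u x - (1 + ε * w x)⁻¹ * v x)
        (-(w x / (1 + ε * w x) * u x * u x) + (deriv w x / (1 + ε * w x) ^ 2 * u x
          - -(ε * deriv w x) / (1 + ε * w x) ^ 2 * v x)
          - 2 * ϰ * (w x / (1 + ε * w x) * u x - (1 + ε * w x)⁻¹ * v x)) x := by
      intro x
      convert! ((hW x).mul (hu x)).sub ((hθ x).mul (hv x)) using 1
      rw [div_eq_mul_inv (w x)]
      ring
    have hWuu : MemLp (fun x => -(w x / (1 + ε * w x) * u x * u x)) 1 volume :=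
      memLp_one_iff_integrable.2 (hWu.integrable_mul hu2).neg
    have bound := eLpNorm_le_of_hasDerivAt ha0 (by norm_num) hC ((hWc.mul huc).mul huc).neg
      (c₁.sub c₂) hWuu (m₁.sub m₂) hd (hWu.sub mθ)
    have bd : eLpNorm (fun x => w x / (1 + ε * w x) * u x - (1 + ε * w x)⁻¹ * v x) 2 volume
        ≤ ENNReal.ofReal (1 / 100) * A
          + ENNReal.ofReal (1 / 200) * (A + eLpNorm v 2 volume) := by
      refine bound.trans (add_le_add ?_ (mul_le_mul' (ENNReal.ofReal_le_ofReal ?_) ?_))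
      · have e : eLpNorm (fun x => -(w x / (1 + ε * w x) * u x * u x)) 1 volume
            = eLpNorm (fun x => w x / (1 + ε * w x) * u x * u x) 1 volume := eLpNorm_neg _ _ _
        refine (mul_le_mul_right (e.le.trans (eLpNorm_one_mul_le hWu.1 hu2.1)) _).trans ?_
        refine (mul_le_mul_right (mul_le_mul_right hun _) _).trans (le_of_eq ?_)
        rw [mul_comm (eLpNorm _ _ _), ← mul_assoc, ← ENNReal.ofReal_mul (by norm_num)]
        rw [hA]
        norm_num
      · exact one_div_le_one_div_of_le (by norm_num) (by linarith)
      · exact (eLpNorm_sub_le m₁.1 m₂.1 (by norm_num)).trans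
          (add_le_add (eLpNorm_mono n₁) (eLpNorm_mono n₂))
    refine le_mul_of_le_mul_add_mul (α := 3 / 200) (β := 201 / 200) hWu.2.ne hv2.2.ne (by norm_num)
      (by norm_num) (by norm_num) (by norm_num) ?_
    have htri : A ≤ eLpNorm (fun x => w x / (1 + ε * w x) * u x - (1 + ε * w x)⁻¹ * v x) 2 volume
        + eLpNorm v 2 volume := by
      have h1 := eLpNorm_add_le (hWu.sub mθ).1 mθ.1 (p := 2) (μ := volume) (by norm_num)
      rw [sub_add_cancel] at h1
      exact h1.trans (add_le_add le_rfl (eLpNorm_mono nθ))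
    refine htri.trans ((add_le_add bd le_rfl).trans (le_of_eq ?_))
    rw [show (3 / 200 : ℝ) = 1 / 100 + 1 / 200 by norm_num,
      show (201 / 200 : ℝ) = 1 / 200 + 1 by norm_num,
      ENNReal.ofReal_add (by norm_num) (by norm_num),
      ENNReal.ofReal_add (by norm_num) (by norm_num),
      ENNReal.ofReal_one]
    ring
  refine (Lp.eLpNorm_lim_le_liminf_eLpNorm
    (f := fun n : ℕ => fun x => w x / (1 + 1 / ((n : ℝ) + 1) * w x) * u x) (fun n => ?_) _
    (Filter.Eventually.of_forall fun x => ?_)).trans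
    (Filter.liminf_le_of_frequently_le' (Filter.Frequently.of_forall fun n =>
      key _ Nat.one_div_pos_of_nat))
  · refine Continuous.aestronglyMeasurable (Continuous.mul (hwc.div (by fun_prop) fun x => ?_) huc)
    have := hw0 x
    positivity
  · have h1 : Filter.Tendsto (fun n : ℕ => 1 + 1 / ((n : ℝ) + 1) * w x) Filter.atTop
        (nhds (1 + 0 * w x)) :=
      ((tendsto_one_div_add_atTop_nhds_zero_nat (𝕜 := ℝ)).mul_const _).const_add _
    have h2 := ((tendsto_const_nhds (x := w x)).div h1 (by simp)).mul_const (u x)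
    simpa using h2

/-! ### The free resolvent as a contraction in the energy norm -/

/-- The anticausal solution `x ↦ ∫_{y ≥ x} e^{-a(y-x)} h(y) dy` of `-v' + a v = h`: the causal one
conjugated by reflection. -/
def anticausal (a : ℝ) (h : ℝ → ℝ) (x : ℝ) : ℝ := causal a (fun y => h (-y)) (-x)

lemma hasDerivAt_anticausal {a : ℝ} (ha : 0 < a) {h : ℝ → ℝ} (hh : Continuous h)
    (hi : Integrable h) (x : ℝ) :
    HasDerivAt (anticausal a h) (a * anticausal a h x - h x) x := by
  have h1 := hasDerivAt_causal (h := fun y => h (-y)) (hh.comp continuous_neg)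
    (integrableOn_exp_mul_of_integrable ha hi.comp_neg) (-x)
  have h2 := h1.scomp x (hasDerivAt_neg x)
  convert! h2 using 1
  simp [anticausal]

lemma freeResolvent_eq {ϰ : ℝ} (hϰ : 0 < ϰ) {h : ℝ → ℝ} (hi : Integrable h) (x : ℝ) :
    freeResolvent ϰ h x = (causal ϰ h x + anticausal ϰ h x) / (2 * ϰ) := by
  have hb : Integrable fun y => freeKernel ϰ x y * h y := by
    refine hi.bdd_mul (c := 1 / (2 * ϰ)) (Continuous.aestronglyMeasurable ?_)
      (Filter.Eventually.of_forall fun y => ?_)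
    · unfold freeKernel
      fun_prop
    · rw [freeKernel, Real.norm_of_nonneg (by positivity)]
      gcongr
      rw [Real.exp_le_one_iff]
      have := abs_nonneg (x - y)
      nlinarith
  have h1 : ∫ y in Set.Iic x, freeKernel ϰ x y * h y = causal ϰ h x / (2 * ϰ) := by
    rw [causal, ← integral_const_mul, ← integral_div]
    refine setIntegral_congr_fun measurableSet_Iic fun y hy => ?_
    simp only [freeKernel]
    rw [abs_of_nonneg (sub_nonneg.2 hy), ← mul_assoc, ← Real.exp_add, mul_div_right_comm]
    congr 3
    ring
  have h2 : ∫ y in Set.Ioi x, freeKernel ϰ x y * h y = anticausal ϰ h x / (2 * ϰ) := by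
    rw [anticausal, causal, ← integral_const_mul, ← integral_div]
    rw [← integral_Ici_eq_integral_Ioi]
    have := integral_comp_neg_Iic (-x) (fun y => freeKernel ϰ x y * h y)
    rw [neg_neg] at this
    rw [integral_Ici_eq_integral_Ioi, ← this]
    refine setIntegral_congr_fun measurableSet_Iic fun y hy => ?_
    have hy' : y ≤ -x := hy
    simp only [freeKernel]
    rw [abs_of_nonpos (by linarith), ← mul_assoc, ← Real.exp_add, mul_div_right_comm]
    congr 3
    ring
  rw [freeResolvent, ← intervalIntegral.integral_Iic_add_Ioi hb.integrableOn hb.integrableOn, h1,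
    h2, add_div]

/-- `f` is continuously differentiable with derivative `f'`, and both are in `L²`. -/
structure IsH1 (f f' : ℝ → ℝ) : Prop where
  hasDerivAt : ∀ x, HasDerivAt f (f' x) x
  continuous_deriv : Continuous f'
  memLp : MemLp f 2 volume
  memLp_deriv : MemLp f' 2 volume

lemma IsH1.continuous {f f' : ℝ → ℝ} (hf : IsH1 f f') : Continuous f :=
  continuous_iff_continuousAt.2 fun x => (hf.hasDerivAt x).continuousAt

/-- The squared energy norm `∫ f'² + ϰ² f²`. -/
def energy (ϰ : ℝ) (f f' : ℝ → ℝ) : ℝ := ∫ x, f' x ^ 2 + ϰ ^ 2 * f x ^ 2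

lemma IsH1.integrable_energy {f f' : ℝ → ℝ} (hf : IsH1 f f') (ϰ : ℝ) :
    Integrable fun x => f' x ^ 2 + ϰ ^ 2 * f x ^ 2 :=
  hf.memLp_deriv.integrable_sq.add (hf.memLp.integrable_sq.const_mul _)

lemma energy_nonneg (ϰ : ℝ) (f f' : ℝ → ℝ) : 0 ≤ energy ϰ f f' :=
  integral_nonneg fun x => by positivity

lemma IsH1.integral_deriv_sq_le {f f' : ℝ → ℝ} (hf : IsH1 f f') (ϰ : ℝ) :
    ∫ x, f' x ^ 2 ≤ energy ϰ f f' :=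
  integral_mono hf.memLp_deriv.integrable_sq (hf.integrable_energy ϰ) fun x => by
    simp only
    nlinarith [mul_nonneg (sq_nonneg ϰ) (sq_nonneg (f x))]

lemma IsH1.integral_sq_le {f f' : ℝ → ℝ} (hf : IsH1 f f') (ϰ : ℝ) :
    ϰ ^ 2 * ∫ x, f x ^ 2 ≤ energy ϰ f f' := by
  rw [← integral_const_mul]
  exact integral_mono (hf.memLp.integrable_sq.const_mul _) (hf.integrable_energy ϰ) fun x => by
    simp only
    nlinarith [sq_nonneg (f' x)]

/-- The one-dimensional Sobolev inequality. -/
lemma IsH1.mul_sq_le_energy {f f' : ℝ → ℝ} (hf : IsH1 f f') {ϰ : ℝ} (hϰ : 0 < ϰ) (x : ℝ) :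
    ϰ * f x ^ 2 ≤ energy ϰ f f' := by
  have hd : ∀ y, HasDerivAt (fun y => ϰ * f y ^ 2) (ϰ * (2 * f y * f' y)) y := fun y => by
    convert! ((hf.hasDerivAt y).pow 2).const_mul ϰ using 1
    ring
  have hi' : Integrable fun y => ϰ * (2 * f y * f' y) := by
    have := (hf.memLp.integrable_mul hf.memLp_deriv).const_mul (ϰ * 2)
    refine this.congr (Filter.Eventually.of_forall fun y => ?_)
    simp only [Pi.mul_apply]
    ring
  have hi : Integrable fun y => ϰ * f y ^ 2 := hf.memLp.integrable_sq.const_mul ϰ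
  have h0 := tendsto_zero_of_hasDerivAt_of_integrableOn_Iic (a := x) (fun y _ => hd y)
    hi'.integrableOn hi.integrableOn
  have h1 := integral_Iic_of_hasDerivAt_of_tendsto' (a := x) (fun y _ => hd y) hi'.integrableOn h0
  rw [sub_zero] at h1
  rw [← h1]
  refine (setIntegral_mono hi'.integrableOn (hf.integrable_energy ϰ).integrableOn fun y => ?_).trans
    (setIntegral_le_integral (hf.integrable_energy ϰ)
      (Filter.Eventually.of_forall fun y => by positivity))
  simp only
  nlinarith [sq_nonneg (f' y - ϰ * f y)]

lemma integral_abs_mul_le {f g : ℝ → ℝ} (hf : MemLp f 2 volume) (hg : MemLp g 2 volume) :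
    ∫ x, |f x| * |g x| ≤ √(∫ x, f x ^ 2) * √(∫ x, g x ^ 2) := by
  have h := integral_mul_norm_le_Lp_mul_Lq (μ := (volume : Measure ℝ))
    Real.HolderConjugate.two_two (f := f) (g := g) (by simpa using hf) (by simpa using hg)
  simpa [Real.sqrt_eq_rpow] using h

/-- The quadratic form of the potential `q = φ' + aφ` on `H¹`, after integration by parts. -/
lemma integral_potential_eq {a : ℝ} {q φ f f' k k' : ℝ → ℝ}
    (hφ : ∀ x, HasDerivAt φ (q x - a * φ x) x) (hqk : Integrable fun x => q x * k x * f x)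
    (hφ2 : MemLp φ 2 volume) (hf : IsH1 f f') (hk : IsH1 k k') {Cf Ck : ℝ}
    (hCf : ∀ x, |f x| ≤ Cf) (hCk : ∀ x, |k x| ≤ Ck) :
    ∫ x, q x * k x * f x = ∫ x, φ x * (a * k x * f x - (k' x * f x + k x * f' x)) := by
  have hkc := hk.continuous
  have hfc := hf.continuous
  have i0 : Integrable fun x => k x * (φ x * f x) :=
    (hφ2.integrable_mul hf.memLp).bdd_mul (c := Ck) hkc.aestronglyMeasurable
      (Filter.Eventually.of_forall hCk)
  have i1 : Integrable fun x => f x * (φ x * k' x) :=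
    (hφ2.integrable_mul hk.memLp_deriv).bdd_mul (c := Cf) hfc.aestronglyMeasurable
      (Filter.Eventually.of_forall hCf)
  have i2 : Integrable fun x => k x * (φ x * f' x) :=
    (hφ2.integrable_mul hf.memLp_deriv).bdd_mul (c := Ck) hkc.aestronglyMeasurable
      (Filter.Eventually.of_forall hCk)
  have i3 : Integrable fun x => φ x * (a * k x * f x - (k' x * f x + k x * f' x)) := by
    refine (((i0.const_mul a).sub i1).sub i2).congr (Filter.Eventually.of_forall fun x => ?_)
    simp only [Pi.sub_apply]
    ring
  have hd : ∀ x, HasDerivAt (fun x => φ x * (k x * f x))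
      (q x * k x * f x - φ x * (a * k x * f x - (k' x * f x + k x * f' x))) x := fun x => by
    convert! (hφ x).mul ((hk.hasDerivAt x).mul (hf.hasDerivAt x)) using 1
    simp only [Pi.mul_apply]
    ring
  have h0 := integral_eq_zero_of_hasDerivAt_of_integrable hd (hqk.sub i3)
    (i0.congr (Filter.Eventually.of_forall fun x => by ring))
  rw [integral_sub hqk i3] at h0
  linarith

/-- The potential is a small form perturbation of the energy, with relative bound controlled by the
`L²` norm of `φ = (∂ + 2ϰ)⁻¹ q`, that is, by the `H⁻¹` norm of `q`. -/
lemma integral_potential_le {ϰ : ℝ} (hϰ : 100 ≤ ϰ) {q φ f f' k k' : ℝ → ℝ}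
    (hφ : ∀ x, HasDerivAt φ (q x - 2 * ϰ * φ x) x) (hqk : Integrable fun x => q x * k x * f x)
    (hφ2 : MemLp φ 2 volume) (hφn : √(∫ x, φ x ^ 2) ≤ 1 / 10) (hf : IsH1 f f') (hk : IsH1 k k') :
    ∫ x, q x * k x * f x ≤ 1 / 25 * (√(energy ϰ k k') * √(energy ϰ f f')) := by
  have hϰ0 : 0 < ϰ := by linarith
  have sup : ∀ {g g' : ℝ → ℝ}, IsH1 g g' → ∀ x, |g x| ≤ √(energy ϰ g g') / 10 := by
    intro g g' hg x
    have h1 := hg.mul_sq_le_energy hϰ0 x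
    rw [le_div_iff₀ (by norm_num)]
    apply Real.le_sqrt_of_sq_le
    rw [mul_pow, sq_abs]
    nlinarith [sq_nonneg (g x)]
  set ek := √(energy ϰ k k') with hek
  set ef := √(energy ϰ f f') with hef
  have hek0 : 0 ≤ ek := Real.sqrt_nonneg _
  have hef0 : 0 ≤ ef := Real.sqrt_nonneg _
  rw [integral_potential_eq hφ hqk hφ2 hf hk (sup hf) (sup hk)]
  have cs : ∀ {g : ℝ → ℝ}, MemLp g 2 volume → ∫ x, |φ x| * |g x| ≤ 1 / 10 * √(∫ x, g x ^ 2) :=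
    fun hg => (integral_abs_mul_le hφ2 hg).trans (by gcongr)
  have c0 : ∫ x, |φ x| * |f x| ≤ 1 / 10 * (ef / ϰ) := by
    refine (cs hf.memLp).trans ?_
    gcongr
    rw [le_div_iff₀ hϰ0, ← Real.sqrt_sq hϰ0.le, ← Real.sqrt_mul' _ (sq_nonneg ϰ), hef]
    exact Real.sqrt_le_sqrt (by rw [mul_comm]; exact hf.integral_sq_le ϰ)
  have c1 : ∫ x, |φ x| * |k' x| ≤ 1 / 10 * ek :=
    (cs hk.memLp_deriv).trans (by gcongr; exact Real.sqrt_le_sqrt (hk.integral_deriv_sq_le ϰ))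
  have c2 : ∫ x, |φ x| * |f' x| ≤ 1 / 10 * ef :=
    (cs hf.memLp_deriv).trans (by gcongr; exact Real.sqrt_le_sqrt (hf.integral_deriv_sq_le ϰ))
  have j0 : Integrable fun x => |φ x| * |f x| := by
    simpa only [Pi.mul_apply, abs_mul] using! (hφ2.integrable_mul hf.memLp).abs
  have j1 : Integrable fun x => |φ x| * |k' x| := by
    simpa only [Pi.mul_apply, abs_mul] using! (hφ2.integrable_mul hk.memLp_deriv).abs
  have j2 : Integrable fun x => |φ x| * |f' x| := by
    simpa only [Pi.mul_apply, abs_mul] using! (hφ2.integrable_mul hf.memLp_deriv).abs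
  have jj : Integrable fun x => 2 * ϰ * (ek / 10) * (|φ x| * |f x|)
      + ef / 10 * (|φ x| * |k' x|) + ek / 10 * (|φ x| * |f' x|) :=
    ((j0.const_mul _).add (j1.const_mul _)).add (j2.const_mul _)
  have hle : ∫ x, φ x * (2 * ϰ * k x * f x - (k' x * f x + k x * f' x))
      ≤ ∫ x, 2 * ϰ * (ek / 10) * (|φ x| * |f x|)
      + ef / 10 * (|φ x| * |k' x|) + ek / 10 * (|φ x| * |f' x|) := by
    refine ((le_abs_self _).trans abs_integral_le_integral_abs).trans (integral_mono_of_nonneg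
      (Filter.Eventually.of_forall fun x => abs_nonneg _) jj
      (Filter.Eventually.of_forall fun x => ?_))
    simp only
    have t1 : |2 * ϰ * k x * f x| ≤ 2 * ϰ * (ek / 10) * |f x| := by
      rw [abs_mul, abs_mul, abs_of_pos (by positivity : 0 < 2 * ϰ)]
      gcongr
      exact sup hk x
    have t2 : |k' x * f x| ≤ ef / 10 * |k' x| := by
      rw [abs_mul, mul_comm]
      gcongr
      exact sup hf x
    have t3 : |k x * f' x| ≤ ek / 10 * |f' x| := by
      rw [abs_mul]
      gcongr
      exact sup hk x
    have t4 : |2 * ϰ * k x * f x - (k' x * f x + k x * f' x)|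
        ≤ 2 * ϰ * (ek / 10) * |f x| + (ef / 10 * |k' x| + ek / 10 * |f' x|) :=
      (abs_sub _ _).trans (add_le_add t1 ((abs_add_le _ _).trans (add_le_add t2 t3)))
    rw [abs_mul]
    refine (mul_le_mul_of_nonneg_left t4 (abs_nonneg _)).trans (le_of_eq ?_)
    ring
  refine hle.trans ?_
  have jj' : Integrable fun x => 2 * ϰ * (ek / 10) * (|φ x| * |f x|)
      + ef / 10 * (|φ x| * |k' x|) := (j0.const_mul _).add (j1.const_mul _)
  rw [integral_add jj' (j2.const_mul _), integral_add (j0.const_mul _) (j1.const_mul _),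
    integral_const_mul, integral_const_mul, integral_const_mul]
  have d0 : 2 * ϰ * (ek / 10) * ∫ x, |φ x| * |f x| ≤ 2 * ϰ * (ek / 10) * (1 / 10 * (ef / ϰ)) := by
    gcongr
  have d1 : ef / 10 * ∫ x, |φ x| * |k' x| ≤ ef / 10 * (1 / 10 * ek) := by gcongr
  have d2 : ek / 10 * ∫ x, |φ x| * |f' x| ≤ ek / 10 * (1 / 10 * ef) := by gcongr
  have e0 : 2 * ϰ * (ek / 10) * (1 / 10 * (ef / ϰ)) = ek * ef / 50 := by
    field_simp
    ring
  nlinarith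

lemma memLp_causal_of_integrable {a : ℝ} (ha : 0 < a) {h : ℝ → ℝ} (hi : Integrable h) :
    MemLp (causal a h) 2 volume := by
  have hC : 1 ≤ 2 * a * (√(1 / (2 * a))) ^ 2 := by
    rw [Real.sq_sqrt (by positivity)]
    field_simp
    exact le_rfl
  exact ⟨(continuous_causal (integrableOn_exp_mul_of_integrable ha hi)).aestronglyMeasurable,
    (eLpNorm_causal_le_L1 ha (Real.sqrt_nonneg _) hC hi.1).trans_lt
      (ENNReal.mul_lt_top ENNReal.ofReal_lt_top (memLp_one_iff_integrable.2 hi).2)⟩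

lemma memLp_comp_neg {f : ℝ → ℝ} (hf : MemLp f 2 volume) : MemLp (fun x => f (-x)) 2 volume :=
  hf.comp_measurePreserving (Measure.measurePreserving_neg volume)

lemma isH1_freeResolvent {ϰ : ℝ} (hϰ : 0 < ϰ) {h : ℝ → ℝ} (hh : Continuous h)
    (hi : Integrable h) :
    IsH1 (freeResolvent ϰ h) (fun x => (anticausal ϰ h x - causal ϰ h x) / 2) := by
  have i1 := integrableOn_exp_mul_of_integrable hϰ hi
  have mc := memLp_causal_of_integrable hϰ hi
  have ma : MemLp (anticausal ϰ h) 2 volume := memLp_comp_neg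
    (memLp_causal_of_integrable hϰ hi.comp_neg)
  have dc := hasDerivAt_causal hh i1
  have da := hasDerivAt_anticausal hϰ hh hi
  have e : freeResolvent ϰ h = fun x => (causal ϰ h x + anticausal ϰ h x) / (2 * ϰ) :=
    funext fun x => freeResolvent_eq hϰ hi x
  have cc : Continuous (causal ϰ h) := continuous_causal i1
  have ca : Continuous (anticausal ϰ h) :=
    continuous_iff_continuousAt.2 fun x => (da x).continuousAt
  rw [e]
  refine ⟨fun x => ?_, by fun_prop, ?_, ?_⟩
  · convert! ((dc x).add (da x)).div_const (2 * ϰ) using 1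
    field_simp
    ring
  · simpa only [div_eq_inv_mul] using! (mc.add ma).const_mul (2 * ϰ)⁻¹
  · simpa only [div_eq_inv_mul] using! (ma.sub mc).const_mul (2 : ℝ)⁻¹

/-- The energy identity for `f = R₀ h`. -/
lemma energy_freeResolvent {ϰ : ℝ} (hϰ : 0 < ϰ) {h : ℝ → ℝ} (hh : Continuous h)
    (hi : Integrable h) (hhf : Integrable fun x => h x * freeResolvent ϰ h x) :
    energy ϰ (freeResolvent ϰ h) (fun x => (anticausal ϰ h x - causal ϰ h x) / 2)
      = ∫ x, h x * freeResolvent ϰ h x := by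
  have H := isH1_freeResolvent hϰ hh hi
  have i1 := integrableOn_exp_mul_of_integrable hϰ hi
  have d2 : ∀ x, HasDerivAt (fun x => (anticausal ϰ h x - causal ϰ h x) / 2)
      (ϰ ^ 2 * freeResolvent ϰ h x - h x) x := fun x => by
    convert! ((hasDerivAt_anticausal hϰ hh hi x).sub
      (hasDerivAt_causal hh i1 x)).div_const 2 using 1
    rw [freeResolvent_eq hϰ hi]
    field_simp
    ring
  have hd : ∀ x, HasDerivAt
      (fun x => freeResolvent ϰ h x * ((anticausal ϰ h x - causal ϰ h x) / 2))
      ((((anticausal ϰ h x - causal ϰ h x) / 2) ^ 2 + ϰ ^ 2 * freeResolvent ϰ h x ^ 2)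
        - h x * freeResolvent ϰ h x) x := fun x => by
    convert! (H.hasDerivAt x).mul (d2 x) using 1
    ring
  have := integral_eq_zero_of_hasDerivAt_of_integrable hd ((H.integrable_energy ϰ).sub hhf)
    (H.memLp.integrable_mul H.memLp_deriv)
  rw [integral_sub (H.integrable_energy ϰ) hhf] at this
  rw [energy]
  linarith

/-- The operator `f ↦ R₀(ϰ)(q f)` of the Neumann series. -/
def neumannStep (q : ℝ → ℝ) (ϰ : ℝ) (f : ℝ → ℝ) : ℝ → ℝ :=
  freeResolvent ϰ fun z => q z * f z

lemma integrable_mul_of_bounded {q f : ℝ → ℝ} (hqi : Integrable q) (hf : Continuous f) {C : ℝ}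
    (hC : ∀ x, |f x| ≤ C) : Integrable fun x => q x * f x :=
  hqi.mul_bdd (c := C) hf.aestronglyMeasurable (Filter.Eventually.of_forall hC)

lemma IsH1.abs_le {f f' : ℝ → ℝ} (hf : IsH1 f f') (x : ℝ) : |f x| ≤ √(energy 1 f f') := by
  apply Real.le_sqrt_of_sq_le
  rw [sq_abs]
  simpa using hf.mul_sq_le_energy one_pos x

/-- Iterates of the Neumann operator on a bounded continuous function decay geometrically. -/
lemma exists_iterate_neumannStep_le {ϰ : ℝ} (hϰ : 100 ≤ ϰ) {q φ : ℝ → ℝ} (hq : Continuous q)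
    (hqi : Integrable q) (hφ : ∀ x, HasDerivAt φ (q x - 2 * ϰ * φ x) x) (hφ2 : MemLp φ 2 volume)
    (hφn : √(∫ x, φ x ^ 2) ≤ 1 / 10) {K : ℝ → ℝ} (hK : Continuous K) {M : ℝ}
    (hM : ∀ x, |K x| ≤ M) :
    ∃ C : ℝ, ∀ n, Continuous ((neumannStep q ϰ)^[n] K) ∧
      ∀ x, |(neumannStep q ϰ)^[n] K x| ≤ C * (1 / 25) ^ n := by
  have hϰ0 : 0 < ϰ := by linarith
  have hH : ∀ n, ∃ f', IsH1 ((neumannStep q ϰ)^[n + 1] K) f' ∧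
      √(energy ϰ ((neumannStep q ϰ)^[n + 1] K) f')
        ≤ √(energy ϰ (neumannStep q ϰ K)
          (fun x => (anticausal ϰ (fun z => q z * K z) x - causal ϰ (fun z => q z * K z) x) / 2))
          * (1 / 25) ^ n := by
    intro n
    induction n with
    | zero =>
      refine ⟨_, isH1_freeResolvent hϰ0 (hq.mul hK) (integrable_mul_of_bounded hqi hK hM), ?_⟩
      simp [neumannStep]
    | succ n ih =>
      obtain ⟨k', hk, hke⟩ := ih
      rw [Function.iterate_succ_apply']
      set k := (neumannStep q ϰ)^[n + 1] K with hkdef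
      have hqk := integrable_mul_of_bounded hqi hk.continuous hk.abs_le
      have hqkc : Continuous fun z => q z * k z := hq.mul hk.continuous
      have hf := isH1_freeResolvent hϰ0 hqkc hqk
      have hqkf := integrable_mul_of_bounded hqk hf.continuous hf.abs_le
      refine ⟨_, hf, ?_⟩
      have e1 := energy_freeResolvent hϰ0 hqkc hqk hqkf
      have e2 := integral_potential_le hϰ hφ hqkf hφ2 hφn hf hk
      rw [← e1] at e2
      change √(energy ϰ (freeResolvent ϰ fun z => q z * k z) _) ≤ _
      set E := energy ϰ (freeResolvent ϰ fun z => q z * k z)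
        (fun x => (anticausal ϰ (fun z => q z * k z) x - causal ϰ (fun z => q z * k z) x) / 2)
      have hE0 : 0 ≤ E := energy_nonneg _ _ _
      have e3 : √E ≤ 1 / 25 * √(energy ϰ k k') := by
        rcases eq_or_lt_of_le (Real.sqrt_nonneg E) with h | h
        · rw [← h]; positivity
        · refine le_of_mul_le_mul_right ?_ h
          rw [Real.mul_self_sqrt hE0]
          linarith
      refine e3.trans ?_
      rw [pow_succ]
      linarith
  set e₁ := √(energy ϰ (neumannStep q ϰ K)
    (fun x => (anticausal ϰ (fun z => q z * K z) x - causal ϰ (fun z => q z * K z) x) / 2))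
  have he₁ : 0 ≤ e₁ := Real.sqrt_nonneg _
  have hM0 : 0 ≤ M := (abs_nonneg _).trans (hM 0)
  refine ⟨M + 25 * e₁, fun n => ?_⟩
  cases n with
  | zero => exact ⟨hK, fun x => by simpa using (hM x).trans (by linarith)⟩
  | succ n =>
    obtain ⟨f', hf, hfe⟩ := hH n
    refine ⟨hf.continuous, fun x => ?_⟩
    have h1 := hf.mul_sq_le_energy hϰ0 x
    have h2 : |(neumannStep q ϰ)^[n + 1] K x| ≤ √(energy ϰ ((neumannStep q ϰ)^[n + 1] K) f') := by
      apply Real.le_sqrt_of_sq_le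
      rw [sq_abs]
      nlinarith [sq_nonneg ((neumannStep q ϰ)^[n + 1] K x)]
    refine h2.trans (hfe.trans ?_)
    have h3 : 0 ≤ M * (1 / 25) ^ (n + 1) := by positivity
    rw [add_mul]
    rw [pow_succ] at h3 ⊢
    linarith

lemma neumannStep_add {ϰ : ℝ} (hϰ : 0 < ϰ) {q : ℝ → ℝ} (hqi : Integrable q) {f g : ℝ → ℝ}
    (hf : Continuous f) (hg : Continuous g) {C D : ℝ} (hC : ∀ x, |f x| ≤ C)
    (hD : ∀ x, |g x| ≤ D) :
    neumannStep q ϰ (fun x => f x + g x) = fun x => neumannStep q ϰ f x + neumannStep q ϰ g x := by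
  have i1 := integrable_mul_of_bounded hqi hf hC
  have i2 := integrable_mul_of_bounded hqi hg hD
  ext x
  simp only [neumannStep]
  rw [freeResolvent_eq hϰ i1, freeResolvent_eq hϰ i2]
  have i3 : Integrable fun x => q x * f x + q x * g x := i1.add i2
  simp_rw [mul_add]
  rw [freeResolvent_eq hϰ i3,
    causal_add (integrableOn_exp_mul_of_integrable hϰ i1)
      (integrableOn_exp_mul_of_integrable hϰ i2),
    anticausal, causal_add (integrableOn_exp_mul_of_integrable hϰ i1.comp_neg)
      (integrableOn_exp_mul_of_integrable hϰ i2.comp_neg)]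
  simp only [anticausal]
  ring

/-- A bounded continuous solution `K` of the resolvent equation `K + R₀(qK) = G_y` is the sum of
the Neumann series: applying `R₀ q` repeatedly makes the series telescope. -/
lemma hasSum_neumannTerm {ϰ : ℝ} (hϰ : 100 ≤ ϰ) {q φ : ℝ → ℝ} (hq : Continuous q)
    (hqi : Integrable q) (hφ : ∀ x, HasDerivAt φ (q x - 2 * ϰ * φ x) x) (hφ2 : MemLp φ 2 volume)
    (hφn : √(∫ x, φ x ^ 2) ≤ 1 / 10) {K : ℝ → ℝ} (hK : Continuous K) {M : ℝ}
    (hM : ∀ x, |K x| ≤ M) {y : ℝ}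
    (heq : ∀ x, freeKernel ϰ x y = K x + neumannStep q ϰ K x) (x : ℝ) :
    HasSum (fun ℓ : ℕ => neumannTerm q ϰ ℓ x y) (K x) := by
  have hϰ0 : 0 < ϰ := by linarith
  obtain ⟨C, hC⟩ := exists_iterate_neumannStep_le hϰ hq hqi hφ hφ2 hφn hK hM
  have hiter : ∀ n, (neumannStep q ϰ)^[n] (fun z => freeKernel ϰ z y)
      = fun x => (neumannStep q ϰ)^[n] K x + (neumannStep q ϰ)^[n + 1] K x := by
    intro n
    induction n with
    | zero => ext x; exact heq x
    | succ n ih =>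
      rw [Function.iterate_succ_apply', ih,
        neumannStep_add hϰ0 hqi (hC n).1 (hC (n + 1)).1 (hC n).2 (hC (n + 1)).2,
        ← Function.iterate_succ_apply' (neumannStep q ϰ),
        ← Function.iterate_succ_apply' (neumannStep q ϰ)]
  set s : ℕ → ℝ := fun n => (-1) ^ n * (neumannStep q ϰ)^[n] K x with hs
  have hsum : Summable s := by
    refine Summable.of_norm_bounded (g := fun n => C * (1 / 25) ^ n)
      ((summable_geometric_of_lt_one (by norm_num) (by norm_num)).mul_left C) fun n => ?_
    rw [hs]
    simpa using (hC n).2 x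
  have h1 := hsum.hasSum
  have h2 := (hasSum_nat_add_iff' 1).2 h1
  have h3 := h1.sub h2
  have e1 : (fun ℓ : ℕ => neumannTerm q ϰ ℓ x y) = fun n => s n - s (n + 1) := by
    ext n
    change (-1) ^ n * (neumannStep q ϰ)^[n] (fun z => freeKernel ϰ z y) x = _
    rw [hiter n]
    simp only [hs]
    ring
  have e2 : K x = ∑' n, s n - (∑' n, s n - ∑ i ∈ Finset.range 1, s i) := by
    simp [hs]
  rw [e1, e2]
  exact h3

/-! ### The Green's function in terms of the two Riccati solutions -/

/-- The two Riccati equations say that `ϰ + u` and `-(ϰ + v)` are the logarithmic derivatives of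
solutions of `-ψ'' + (q + ϰ²) ψ = 0` that decay at `-∞` and at `+∞`. -/
structure IsRiccatiPair (q : ℝ → ℝ) (ϰ : ℝ) (u v : ℝ → ℝ) : Prop where
  hasDerivAt_left : ∀ x, HasDerivAt u (q x - u x ^ 2 - 2 * ϰ * u x) x
  hasDerivAt_right : ∀ x, HasDerivAt v (-(q x - v x ^ 2 - 2 * ϰ * v x)) x
  memLp_left : MemLp u 2 volume
  memLp_right : MemLp v 2 volume
  bounded_left : ∃ C, ∀ x, |u x| ≤ C
  bounded_right : ∃ C, ∀ x, |v x| ≤ C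

namespace IsRiccatiPair

variable {q u v : ℝ → ℝ} {ϰ : ℝ}

lemma continuous_left (h : IsRiccatiPair q ϰ u v) : Continuous u :=
  continuous_iff_continuousAt.2 fun x => (h.hasDerivAt_left x).continuousAt

lemma continuous_right (h : IsRiccatiPair q ϰ u v) : Continuous v :=
  continuous_iff_continuousAt.2 fun x => (h.hasDerivAt_right x).continuousAt

lemma reflect (h : IsRiccatiPair q ϰ u v) :
    IsRiccatiPair (fun x => q (-x)) ϰ (fun x => v (-x)) (fun x => u (-x)) where
  hasDerivAt_left x := by
    convert! (h.hasDerivAt_right (-x)).scomp x (hasDerivAt_neg x) using 1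
    simp
  hasDerivAt_right x := by
    convert! (h.hasDerivAt_left (-x)).scomp x (hasDerivAt_neg x) using 1
    simp
  memLp_left := memLp_comp_neg h.memLp_right
  memLp_right := memLp_comp_neg h.memLp_left
  bounded_left := let ⟨C, hC⟩ := h.bounded_right; ⟨C, fun x => hC (-x)⟩
  bounded_right := let ⟨C, hC⟩ := h.bounded_left; ⟨C, fun x => hC (-x)⟩

/-- The Wronskian `p = 2ϰ + u + v` solves the linear equation `p' = (v - u) p`, so it has a sign;
it is positive because `u + v ∈ L²` cannot stay below `-2ϰ`. -/
lemma wronskian_pos (h : IsRiccatiPair q ϰ u v) (hϰ : 0 < ϰ) (x : ℝ) : 0 < 2 * ϰ + u x + v x := by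
  have hu := h.continuous_left
  have hv := h.continuous_right
  have hc : Continuous fun t => v t - u t := hv.sub hu
  have hI : ∀ x, HasDerivAt (fun x => ∫ t in (0 : ℝ)..x, (v t - u t)) (v x - u x) x := fun x =>
    intervalIntegral.integral_hasDerivAt_right (hc.intervalIntegrable _ _)
      (hc.stronglyMeasurableAtFilter _ _) hc.continuousAt
  have hd : ∀ x, HasDerivAt (fun x => (2 * ϰ + u x + v x) *
      Real.exp (-∫ t in (0 : ℝ)..x, (v t - u t))) 0 x := fun x => by
    convert! (((h.hasDerivAt_left x).const_add (2 * ϰ)).add (h.hasDerivAt_right x)).mul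
      (hI x).neg.exp using 1
    simp only [Pi.add_apply]
    ring
  have hconst : ∀ x, (2 * ϰ + u x + v x) * Real.exp (-∫ t in (0 : ℝ)..x, (v t - u t))
      = 2 * ϰ + u 0 + v 0 := fun x => by
    have := is_const_of_deriv_eq_zero (fun x => (hd x).differentiableAt) (fun x => (hd x).deriv) x 0
    simpa using this
  by_cases h0 : 0 < 2 * ϰ + u 0 + v 0
  · have := hconst x
    rw [← this] at h0
    exact pos_of_mul_pos_left h0 (Real.exp_pos _).le
  · exfalso
    have hle : ∀ x, 2 * ϰ ≤ |u x + v x| := fun x => by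
      have h1 : 2 * ϰ + u x + v x ≤ 0 := by
        by_contra! hcon
        exact h0 (by rw [← hconst x]; exact mul_pos hcon (Real.exp_pos _))
      rw [le_abs]
      right
      linarith
    have h2 : MemLp (fun _ : ℝ => 2 * ϰ) 2 volume := by
      refine (h.memLp_left.add h.memLp_right).mono aestronglyMeasurable_const
        (Filter.Eventually.of_forall fun x => ?_)
      rw [Real.norm_of_nonneg (by positivity)]
      exact hle x
    rw [memLp_const_iff (by norm_num) (by norm_num)] at h2
    rcases h2 with h2 | h2
    · linarith
    · simp at h2

end IsRiccatiPair

/-- The kernel `⟨δ_z, R(ϰ) δ_y⟩` of the resolvent, written as `ψ₋(min) ψ₊(max)` over the Wronskian,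
in terms of the logarithmic derivatives `ϰ + u` of `ψ₋` and `-(ϰ + v)` of `ψ₊`. -/
def weylKernel (ϰ : ℝ) (u v : ℝ → ℝ) (y z : ℝ) : ℝ :=
  (if z ≤ y then Real.exp (∫ t in y..z, (ϰ + u t)) else Real.exp (-∫ t in y..z, (ϰ + v t)))
    / (2 * ϰ + u y + v y)

lemma weylKernel_self (ϰ : ℝ) (u v : ℝ → ℝ) (y : ℝ) :
    weylKernel ϰ u v y y = 1 / (2 * ϰ + u y + v y) := by
  simp [weylKernel]

lemma weylKernel_neg (ϰ : ℝ) (u v : ℝ → ℝ) (y z : ℝ) :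
    weylKernel ϰ (fun x => v (-x)) (fun x => u (-x)) (-y) (-z) = weylKernel ϰ u v y z := by
  have e : ∀ f : ℝ → ℝ, ∫ t in (-y)..(-z), (ϰ + f (-t)) = -∫ t in y..z, (ϰ + f t) := fun f => by
    rw [intervalIntegral.integral_comp_neg (fun t => ϰ + f t), neg_neg, neg_neg,
      intervalIntegral.integral_symm]
  rw [weylKernel, weylKernel, e, e]
  simp only [neg_neg]
  rw [add_right_comm]
  congr 1
  rcases lt_trichotomy z y with h | h | h
  · rw [if_neg (by linarith), if_pos h.le]
  · subst h
    simp
  · rw [if_pos (by linarith), if_neg (by linarith)]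

namespace IsRiccatiPair

variable {q u v : ℝ → ℝ} {ϰ : ℝ}

lemma continuous_weylKernel (h : IsRiccatiPair q ϰ u v) (y : ℝ) :
    Continuous (weylKernel ϰ u v y) := by
  have hu := h.continuous_left
  have hv := h.continuous_right
  have c : ∀ {f : ℝ → ℝ}, Continuous f → Continuous fun z => ∫ t in y..z, (ϰ + f t) := fun hf =>
    intervalIntegral.continuous_primitive
      (fun a b => (continuous_const.add hf).intervalIntegrable a b) y
  refine (Continuous.if_le (c hu).rexp (c hv).neg.rexp continuous_id continuous_const
    ?_).div_const _
  rintro z rfl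
  simp

lemma exists_weylKernel_le (h : IsRiccatiPair q ϰ u v) (hϰ : 0 < ϰ) (y : ℝ) :
    ∃ M, ∀ z, |weylKernel ϰ u v y z| ≤ M := by
  -- the elementary inequality `-(ϰ + f) ≤ f² / (4ϰ)` bounds the exponents by the `L²` norm
  have key : ∀ {f : ℝ → ℝ}, Continuous f → MemLp f 2 volume → ∀ {a b : ℝ}, a ≤ b →
      -∫ t in a..b, (ϰ + f t) ≤ ∫ t, f t ^ 2 / (4 * ϰ) := by
    intro f hf hf2 a b hab
    have hi : Integrable fun t => f t ^ 2 / (4 * ϰ) := hf2.integrable_sq.div_const _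
    rw [← intervalIntegral.integral_neg]
    refine (intervalIntegral.integral_mono_on hab
      ((continuous_const.add hf).neg.intervalIntegrable a b) hi.intervalIntegrable
      fun t _ => ?_).trans ?_
    · change -(ϰ + f t) ≤ _
      rw [le_div_iff₀ (by positivity)]
      nlinarith [sq_nonneg (f t + 2 * ϰ)]
    · rw [intervalIntegral.integral_of_le hab]
      exact setIntegral_le_integral hi (Filter.Eventually.of_forall fun t => by positivity)
  have hp := h.wronskian_pos hϰ y
  refine ⟨Real.exp ((∫ t, u t ^ 2 / (4 * ϰ)) + ∫ t, v t ^ 2 / (4 * ϰ)) / (2 * ϰ + u y + v y),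
    fun z => ?_⟩
  have n : ∀ f : ℝ → ℝ, 0 ≤ ∫ t, f t ^ 2 / (4 * ϰ) := fun f =>
    integral_nonneg fun t => by positivity
  have nu := n u
  have nv := n v
  rw [weylKernel, abs_div, abs_of_pos hp]
  gcongr
  split_ifs with hz
  · rw [abs_of_pos (Real.exp_pos _), Real.exp_le_exp]
    have := key h.continuous_left h.memLp_left hz
    rw [← intervalIntegral.integral_symm] at this
    linarith
  · rw [abs_of_pos (Real.exp_pos _), Real.exp_le_exp]
    have := key h.continuous_right h.memLp_right (not_le.1 hz).le
    linarith

lemma integrable_mul_weylKernel (h : IsRiccatiPair q ϰ u v) (hϰ : 0 < ϰ) (hqi : Integrable q)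
    (y : ℝ) : Integrable fun z => q z * weylKernel ϰ u v y z :=
  let ⟨_, hM⟩ := h.exists_weylKernel_le hϰ y
  integrable_mul_of_bounded hqi (h.continuous_weylKernel y) hM

lemma setIntegral_exp_mul_weylKernel_of_le (h : IsRiccatiPair q ϰ u v) (hϰ : 0 < ϰ)
    (hqi : Integrable q) {x y : ℝ} (hxy : x ≤ y) :
    ∫ z in Set.Iic x, Real.exp (ϰ * z) * (q z * weylKernel ϰ u v y z)
      = Real.exp (ϰ * x) * (u x * weylKernel ϰ u v y x) := by
  obtain ⟨M, hM⟩ := h.exists_weylKernel_le hϰ y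
  obtain ⟨C, hC⟩ := h.bounded_left
  have hi := integrableOn_exp_mul_of_integrable hϰ (h.integrable_mul_weylKernel hϰ hqi y) x
  have hu := h.continuous_left
  set k : ℝ → ℝ := fun z => Real.exp (∫ t in y..z, (ϰ + u t)) / (2 * ϰ + u y + v y) with hk
  have hkK : ∀ z ≤ y, weylKernel ϰ u v y z = k z := fun z hz => by
    rw [weylKernel, if_pos hz]
  have hc : Continuous fun t => ϰ + u t := continuous_const.add hu
  have hI : ∀ x, HasDerivAt (fun x => ∫ t in y..x, (ϰ + u t)) (ϰ + u x) x := fun x =>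
    intervalIntegral.integral_hasDerivAt_right (hc.intervalIntegrable _ _)
      (hc.stronglyMeasurableAtFilter _ _) hc.continuousAt
  have hkd : ∀ z, HasDerivAt k ((ϰ + u z) * k z) z := fun z => by
    convert! (hI z).exp.div_const (2 * ϰ + u y + v y) using 1
    simp only [hk]
    ring
  have hexp : ∀ z, HasDerivAt (fun z => Real.exp (ϰ * z)) (Real.exp (ϰ * z) * ϰ) z := fun z => by
    have h1 : HasDerivAt (fun z : ℝ => ϰ * z) ϰ z := by
      simpa using (hasDerivAt_id z).const_mul ϰ
    exact h1.exp
  have hF : ∀ z, HasDerivAt (fun z => Real.exp (ϰ * z) * (u z * k z))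
      (Real.exp (ϰ * z) * (q z * k z)) z := fun z => by
    convert! (hexp z).mul ((h.hasDerivAt_left z).mul (hkd z)) using 1
    simp only [Pi.mul_apply]
    ring
  have hi' : IntegrableOn (fun z => Real.exp (ϰ * z) * (q z * k z)) (Set.Iic x) := by
    refine hi.congr_fun (fun z hz => ?_) measurableSet_Iic
    simp only [hkK z (le_trans hz hxy)]
  have h0 : Filter.Tendsto (fun z => Real.exp (ϰ * z) * (u z * k z)) Filter.atBot (nhds 0) := by
    have he : Filter.Tendsto (fun z => Real.exp (ϰ * z)) Filter.atBot (nhds 0) :=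
      Real.tendsto_exp_atBot.comp (Filter.tendsto_id.const_mul_atBot hϰ)
    have hz : Filter.Tendsto (fun z => Real.exp (ϰ * z) * (C * M)) Filter.atBot (nhds 0) := by
      simpa using he.mul_const (C * M)
    refine squeeze_zero_norm' ?_ hz
    filter_upwards [Filter.eventually_le_atBot y] with z hzy
    rw [norm_mul, Real.norm_of_nonneg (Real.exp_pos _).le, norm_mul]
    have hC0 : 0 ≤ C := (abs_nonneg _).trans (hC 0)
    gcongr
    · exact hC z
    · rw [← hkK z hzy]
      exact hM z
  have := integral_Iic_of_hasDerivAt_of_tendsto' (fun z _ => hF z) hi' h0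
  rw [sub_zero, ← hkK x hxy] at this
  rw [← this]
  refine setIntegral_congr_fun measurableSet_Iic fun z hz => ?_
  simp only [hkK z (le_trans hz hxy)]

/-- The left half of the resolvent integral, computed with the antiderivatives
`e^{ϰz} u K` to the left of `y` and `-e^{ϰz} (2ϰ + v) K` to its right. -/
lemma causal_mul_weylKernel (h : IsRiccatiPair q ϰ u v) (hϰ : 0 < ϰ) (hq : Continuous q)
    (hqi : Integrable q) (x y : ℝ) :
    causal ϰ (fun z => q z * weylKernel ϰ u v y z) x = if x ≤ y then u x * weylKernel ϰ u v y x
      else Real.exp (-ϰ * (x - y)) - (2 * ϰ + v x) * weylKernel ϰ u v y x := by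
  rw [causal]
  have hinv : Real.exp (-ϰ * x) * Real.exp (ϰ * x) = 1 := by rw [← Real.exp_add]; simp
  split_ifs with hxy
  · rw [h.setIntegral_exp_mul_weylKernel_of_le hϰ hqi hxy, ← mul_assoc, hinv, one_mul]
  rw [not_le] at hxy
  have hi := integrableOn_exp_mul_of_integrable hϰ (h.integrable_mul_weylKernel hϰ hqi y)
  have hv := h.continuous_right
  set k : ℝ → ℝ := fun z => Real.exp (-∫ t in y..z, (ϰ + v t)) / (2 * ϰ + u y + v y) with hk
  have hp := h.wronskian_pos hϰ y
  have hky : k y = 1 / (2 * ϰ + u y + v y) := by simp [hk]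
  have hkK : ∀ z, y ≤ z → weylKernel ϰ u v y z = k z := fun z hz => by
    rcases eq_or_lt_of_le hz with rfl | hz
    · rw [weylKernel_self, hky]
    · rw [weylKernel, if_neg (not_le.2 hz)]
  have hc : Continuous fun t => ϰ + v t := continuous_const.add hv
  have hI : ∀ x, HasDerivAt (fun x => ∫ t in y..x, (ϰ + v t)) (ϰ + v x) x := fun x =>
    intervalIntegral.integral_hasDerivAt_right (hc.intervalIntegrable _ _)
      (hc.stronglyMeasurableAtFilter _ _) hc.continuousAt
  have hkd : ∀ z, HasDerivAt k (-(ϰ + v z) * k z) z := fun z => by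
    convert! (hI z).neg.exp.div_const (2 * ϰ + u y + v y) using 1
    simp only [hk, Pi.neg_apply]
    ring
  have hkc : Continuous k := continuous_iff_continuousAt.2 fun z => (hkd z).continuousAt
  have hexp : ∀ z, HasDerivAt (fun z => Real.exp (ϰ * z)) (Real.exp (ϰ * z) * ϰ) z := fun z => by
    have h1 : HasDerivAt (fun z : ℝ => ϰ * z) ϰ z := by
      simpa using (hasDerivAt_id z).const_mul ϰ
    exact h1.exp
  have hF : ∀ z, HasDerivAt (fun z => -(Real.exp (ϰ * z) * ((2 * ϰ + v z) * k z)))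
      (Real.exp (ϰ * z) * (q z * k z)) z := fun z => by
    convert! ((hexp z).mul (((h.hasDerivAt_right z).const_add (2 * ϰ)).mul (hkd z))).neg using 1
    simp only [Pi.mul_apply]
    ring
  have hcF : Continuous fun z => Real.exp (ϰ * z) * (q z * k z) := by fun_prop
  have e1 : ∫ z in y..x, Real.exp (ϰ * z) * (q z * weylKernel ϰ u v y z)
      = ∫ z in y..x, Real.exp (ϰ * z) * (q z * k z) := by
    refine intervalIntegral.integral_congr fun z hz => ?_
    rw [Set.uIcc_of_le hxy.le] at hz
    simp only [hkK z hz.1]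
  rw [intervalIntegral.integral_eq_sub_of_hasDerivAt (fun z _ => hF z)
    (hcF.intervalIntegrable _ _)] at e1
  have e2 := intervalIntegral.integral_Iic_sub_Iic (hi y) (hi x)
  rw [h.setIntegral_exp_mul_weylKernel_of_le hϰ hqi le_rfl, e1, hkK y le_rfl] at e2
  rw [sub_eq_iff_eq_add.1 e2, hkK x hxy.le, hky]
  have e3 : Real.exp (-ϰ * (x - y)) = Real.exp (-ϰ * x) * Real.exp (ϰ * y) := by
    rw [← Real.exp_add]; congr 1; ring
  rw [e3]
  have e4 : (2 * ϰ + u y + v y) * (1 / (2 * ϰ + u y + v y)) = 1 := mul_one_div_cancel hp.ne'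
  linear_combination (-(2 * ϰ + v x) * k x) * hinv + (Real.exp (-ϰ * x) * Real.exp (ϰ * y)) * e4

/-- The resolvent equation `R₀ = R + R₀ q R` for the kernels. -/
lemma freeKernel_eq (h : IsRiccatiPair q ϰ u v) (hϰ : 0 < ϰ) (hq : Continuous q)
    (hqi : Integrable q) (x y : ℝ) :
    freeKernel ϰ x y = weylKernel ϰ u v y x + neumannStep q ϰ (weylKernel ϰ u v y) x := by
  have h1 := h.causal_mul_weylKernel hϰ hq hqi x y
  have h2 := h.reflect.causal_mul_weylKernel hϰ (hq.comp continuous_neg) hqi.comp_neg (-x) (-y)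
  have e2 : (fun z => q (-z) * weylKernel ϰ (fun x => v (-x)) (fun x => u (-x)) (-y) z)
      = fun z => (fun z => q z * weylKernel ϰ u v y z) (-z) := by
    ext z
    simp only
    rw [← weylKernel_neg ϰ u v y (-z), neg_neg]
  rw [e2, weylKernel_neg] at h2
  rw [neumannStep, freeResolvent_eq hϰ (h.integrable_mul_weylKernel hϰ hqi y), anticausal, h1, h2,
    freeKernel]
  simp only [neg_neg, neg_le_neg_iff]
  rcases lt_trichotomy x y with hxy | rfl | hxy
  · rw [if_pos hxy.le, if_neg (not_le.2 hxy), abs_of_neg (by linarith)]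
    field_simp
    ring_nf
  · have hp := h.wronskian_pos hϰ x
    rw [if_pos le_rfl, if_pos le_rfl, weylKernel_self]
    simp only [sub_self, abs_zero, mul_zero, Real.exp_zero]
    field_simp
    ring
  · rw [if_neg (not_le.2 hxy), if_pos hxy.le, abs_of_pos (by linarith)]
    field_simp
    ring_nf

end IsRiccatiPair

/-! ### The density as a positive quadratic expression and its weighted mass -/

lemma causal_nonneg {a : ℝ} {h : ℝ → ℝ} (h0 : ∀ x, 0 ≤ h x) (x : ℝ) : 0 ≤ causal a h x :=
  mul_nonneg (Real.exp_pos _).le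
    (integral_nonneg fun y => mul_nonneg (Real.exp_pos _).le (h0 y))

lemma ofReal_causal {a : ℝ} (ha : 0 < a) {h : ℝ → ℝ} (hi : Integrable h) (h0 : ∀ x, 0 ≤ h x)
    (x : ℝ) :
    ENNReal.ofReal (causal a h x) = ∫⁻ y, causalKernel a (x - y) * ENNReal.ofReal (h y) := by
  rw [causal, ENNReal.ofReal_mul (Real.exp_pos _).le,
    ofReal_integral_eq_lintegral_ofReal (integrableOn_exp_mul_of_integrable ha hi x)
      (Filter.Eventually.of_forall fun y => mul_nonneg (Real.exp_pos _).le (h0 y)),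
    ← lintegral_const_mul' _ _ ENNReal.ofReal_ne_top, ← lintegral_indicator measurableSet_Iic]
  refine lintegral_congr fun y => ?_
  by_cases hy : y ≤ x
  · rw [Set.indicator_of_mem (by exact hy), causalKernel,
      Set.indicator_of_mem (by simpa using hy), ENNReal.ofReal_mul (Real.exp_pos _).le, ← mul_assoc,
      ← ENNReal.ofReal_mul (Real.exp_pos _).le, ← Real.exp_add]
    congr 3
    ring
  · rw [Set.indicator_of_notMem (by exact hy), causalKernel,
      Set.indicator_of_notMem (by simpa using hy), zero_mul]

/-- The weight may be moved through the causal operator at the price of changing the decay rate of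
its kernel by one, because `w²` varies at most by the factor `e^{|x-y|}`. -/
lemma lintegral_weight_mul_causal {a : ℝ} (ha : 1 < a) {u w : ℝ → ℝ} (hu : Continuous u)
    (hu2 : MemLp u 2 volume) (hw : Continuous w) (hw0 : ∀ x, 0 < w x)
    (hww : ∀ x y, w y / w x ≤ Real.exp (|x - y| / 2)) :
    ENNReal.ofReal (1 / (a + 1)) * eLpNorm (fun x => w x * u x) 2 volume ^ 2
        ≤ ∫⁻ x, ENNReal.ofReal (w x ^ 2 * causal a (fun y => u y ^ 2) x) ∧
      ∫⁻ x, ENNReal.ofReal (w x ^ 2 * causal a (fun y => u y ^ 2) x)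
        ≤ ENNReal.ofReal (1 / (a - 1)) * eLpNorm (fun x => w x * u x) 2 volume ^ 2 := by
  have ha0 : 0 < a := by linarith
  have hsq : ∀ x y, w y ^ 2 ≤ w x ^ 2 * Real.exp |x - y| := fun x y => by
    have h1 := hww x y
    rw [div_le_iff₀ (hw0 x)] at h1
    have h2 := pow_le_pow_left₀ (hw0 y).le h1 2
    rw [mul_pow, ← Real.exp_nat_mul, Nat.cast_ofNat, mul_div_cancel₀ _ two_ne_zero] at h2
    rwa [mul_comm]
  have hn : ∀ y, ‖w y * u y‖ₑ ^ 2 = ENNReal.ofReal (w y ^ 2 * u y ^ 2) := fun y => by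
    rw [← ofReal_norm, ← ENNReal.ofReal_pow (norm_nonneg _), Real.norm_eq_abs, sq_abs, mul_pow]
  have hJ : ∀ x, ENNReal.ofReal (w x ^ 2 * causal a (fun y => u y ^ 2) x)
      = ∫⁻ y, ENNReal.ofReal (w x ^ 2) * (causalKernel a (x - y) * ENNReal.ofReal (u y ^ 2)) :=
    fun x => by
      rw [ENNReal.ofReal_mul (sq_nonneg _),
        ofReal_causal ha0 hu2.integrable_sq (fun _ => sq_nonneg _),
        lintegral_const_mul' _ _ ENNReal.ofReal_ne_top]
  have hm : AEMeasurable fun y => ENNReal.ofReal (w y ^ 2 * u y ^ 2) := by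
    exact (Continuous.measurable (by fun_prop)).ennreal_ofReal.aemeasurable
  simp_rw [hJ, eLpNorm_two_sq, hn]
  have t₁ := lintegral_lintegral_causalKernel (a := a + 1) (by linarith) hm
  have t₂ := lintegral_lintegral_causalKernel (a := a - 1) (by linarith) hm
  rw [← t₁, ← t₂]
  constructor
  · refine lintegral_mono fun x => lintegral_mono fun y => ?_
    simp only [causalKernel]
    by_cases hy : x - y ∈ Set.Ici (0 : ℝ)
    · rw [Set.indicator_of_mem hy, Set.indicator_of_mem hy, ← ENNReal.ofReal_mul (by positivity),
        ← ENNReal.ofReal_mul (by positivity), ← ENNReal.ofReal_mul (by positivity)]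
      apply ENNReal.ofReal_le_ofReal
      have h1 := hsq x y
      rw [abs_of_nonneg hy] at h1
      have h2 : Real.exp (-(a + 1) * (x - y)) * Real.exp (x - y) = Real.exp (-a * (x - y)) := by
        rw [← Real.exp_add]; congr 1; ring
      rw [← h2]
      calc Real.exp (-(a + 1) * (x - y)) * (w y ^ 2 * u y ^ 2)
          ≤ Real.exp (-(a + 1) * (x - y)) * (w x ^ 2 * Real.exp (x - y) * u y ^ 2) := by gcongr
        _ = _ := by ring
    · rw [Set.indicator_of_notMem hy, Set.indicator_of_notMem hy]
      simp
  · refine lintegral_mono fun x => lintegral_mono fun y => ?_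
    simp only [causalKernel]
    by_cases hy : x - y ∈ Set.Ici (0 : ℝ)
    · rw [Set.indicator_of_mem hy, Set.indicator_of_mem hy, ← ENNReal.ofReal_mul (by positivity),
        ← ENNReal.ofReal_mul (by positivity), ← ENNReal.ofReal_mul (by positivity)]
      apply ENNReal.ofReal_le_ofReal
      have h1 := hsq y x
      rw [abs_sub_comm, abs_of_nonneg hy] at h1
      have h2 : Real.exp (-(a - 1) * (x - y)) = Real.exp (-a * (x - y)) * Real.exp (x - y) := by
        rw [← Real.exp_add]; congr 1; ring
      rw [h2]
      calc w x ^ 2 * (Real.exp (-a * (x - y)) * u y ^ 2)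
          ≤ w y ^ 2 * Real.exp (x - y) * (Real.exp (-a * (x - y)) * u y ^ 2) := by gcongr
        _ = _ := by ring
    · rw [Set.indicator_of_notMem hy, Set.indicator_of_notMem hy]
      simp

lemma sqrt_integral_sq_le {f : ℝ → ℝ} {c : ℝ} (hc : 0 ≤ c) (hf : MemLp f 2 volume)
    (h : eLpNorm f 2 volume ≤ ENNReal.ofReal c) : √(∫ x, f x ^ 2) ≤ c := by
  rw [Real.sqrt_le_left hc, integral_eq_lintegral_of_nonneg_ae
    (Filter.Eventually.of_forall fun x => sq_nonneg _) hf.integrable_sq.1]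
  refine ENNReal.toReal_le_of_le_ofReal (sq_nonneg c) ?_
  have h2 := pow_le_pow_left' h 2
  rw [eLpNorm_two_sq, ← ENNReal.ofReal_pow hc] at h2
  refine (lintegral_congr fun x => ?_).trans_le h2
  rw [← ofReal_norm, ← ENNReal.ofReal_pow (norm_nonneg _), Real.norm_eq_abs, sq_abs]

lemma eLpNorm_causal_le_sobolevNorm {ϰ : ℝ} (hϰ : 1 / 2 ≤ ϰ) {q : ℝ → ℝ} (hq : Continuous q)
    (hqi : Integrable q) :
    eLpNorm (causal (2 * ϰ) q) 2 volume ≤ sobolevNorm (-1) (1 / 2) q := by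
  have ha0 : 0 < 2 * ϰ := by linarith
  rw [← sobolevNorm_eq_eLpNorm (by linarith) hq
    (hasDerivAt_causal hq (integrableOn_exp_mul_of_integrable ha0 hqi))
    (memLp_causal_of_integrable ha0 hqi)]
  exact sobolevNorm_neg_one_anti (by norm_num) hϰ q

lemma exists_bound_of_riccati {a : ℝ} (ha : 0 < a) {q u : ℝ → ℝ} (hqi : Integrable q)
    (hu : ∀ x, u x = causal a q x - causal a (fun y => u y ^ 2) x) (hu2 : MemLp u 2 volume) :
    ∃ C, ∀ x, |u x| ≤ C := by
  refine ⟨(∫ y, |q y|) + ∫ y, |u y ^ 2|, fun x => ?_⟩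
  rw [hu x]
  exact (abs_sub _ _).trans
    (add_le_add (abs_causal_le ha hqi x) (abs_causal_le ha hu2.integrable_sq x))

/-- Existence of small Riccati solutions `u` and `v`, with the Neumann series on the diagonal and the
density expressed by them. Smallness of `v` is stated for its reflection, and so is the second term
of the density, which is `(-∂ + 2ϰ)⁻¹ (v²)`. -/
lemma exists_riccatiPair {ϰ : ℝ} (hϰ : 100 ≤ ϰ) {q : ℝ → ℝ} (hq : Continuous q)
    (hqi : Integrable q) (hqn : sobolevNorm (-1) (1 / 2) q ≤ ENNReal.ofReal (1 / 10)) :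
    ∃ u v : ℝ → ℝ, IsRiccatiPair q ϰ u v ∧ eLpNorm u 2 volume ≤ ENNReal.ofReal (1 / 5) ∧
      eLpNorm (fun x => v (-x)) 2 volume ≤ ENNReal.ofReal (1 / 5) ∧
      (∀ x, HasSum (fun ℓ : ℕ => neumannTerm q ϰ ℓ x x) (1 / (2 * ϰ + u x + v x))) ∧
      ∀ x, density q ϰ x = ϰ * (causal (2 * ϰ) (fun y => u y ^ 2) x
        + causal (2 * ϰ) (fun y => v (-y) ^ 2) (-x)) := by
  have hϰ0 : 0 < ϰ := by linarith
  have ha0 : 0 < 2 * ϰ := by linarith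
  have hq' : Continuous fun x => q (-x) := hq.comp continuous_neg
  have hqn' : sobolevNorm (-1) (1 / 2) (fun x => q (-x)) ≤ ENNReal.ofReal (1 / 10) := by
    rwa [sobolevNorm_comp_neg]
  have hφ := memLp_causal_of_integrable ha0 hqi
  have hφn := (eLpNorm_causal_le_sobolevNorm (ϰ := ϰ) (by linarith) hq hqi).trans hqn
  obtain ⟨u, hu, hue, hu2, hun⟩ := exists_riccati (a := 2 * ϰ) (by linarith) hq hqi hφ hφn
  obtain ⟨v, hv, hve, hv2, hvn⟩ := exists_riccati (a := 2 * ϰ) (by linarith) hq' hqi.comp_neg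
    (memLp_causal_of_integrable ha0 hqi.comp_neg)
    ((eLpNorm_causal_le_sobolevNorm (ϰ := ϰ) (by linarith) hq' hqi.comp_neg).trans hqn')
  obtain ⟨C, hC⟩ := exists_bound_of_riccati ha0 hqi hue hu2
  obtain ⟨D, hD⟩ := exists_bound_of_riccati ha0 hqi.comp_neg hve hv2
  have hpair : IsRiccatiPair q ϰ u fun x => v (-x) :=
    { hasDerivAt_left := hu
      hasDerivAt_right := fun x => by
        convert! (hv (-x)).scomp x (hasDerivAt_neg x) using 1
        simp
      memLp_left := hu2
      memLp_right := memLp_comp_neg hv2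
      bounded_left := ⟨C, hC⟩
      bounded_right := ⟨D, fun x => hD (-x)⟩ }
  have hsum : ∀ x, HasSum (fun ℓ : ℕ => neumannTerm q ϰ ℓ x x)
      (1 / (2 * ϰ + u x + v (-x))) := fun x => by
    obtain ⟨M, hM⟩ := hpair.exists_weylKernel_le hϰ0 x
    have := hasSum_neumannTerm hϰ hq hqi
      (hasDerivAt_causal hq (integrableOn_exp_mul_of_integrable ha0 hqi)) hφ
      (sqrt_integral_sq_le (by norm_num) hφ hφn) (hpair.continuous_weylKernel x) hM
      (fun z => hpair.freeKernel_eq hϰ0 hq hqi z x) x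
    rwa [weylKernel_self] at this
  refine ⟨u, fun x => v (-x), hpair, hun, by simpa using hvn, hsum, fun x => ?_⟩
  have hg : diagGreen q ϰ x = 1 / (2 * ϰ + u x + v (-x)) := (hsum x).tsum_eq
  rw [density, hg, freeResolvent_eq ha0 hqi, anticausal]
  have h1 := hue x
  have h2 := hve (-x)
  simp only [neg_neg]
  field_simp
  linear_combination (-4 : ℝ) * h1 - 4 * h2

/-- The numerical end of the argument, in `[0, ∞]`: `A`, `B` are the weighted `L²` norms of the two
Riccati solutions, `I`, `J` the two parts of the weighted mass, and `N` the `H⁻¹` norm. -/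
lemma mass_bounds {ϰ : ℝ} (hϰ : 100 ≤ ϰ) {A B I J N : ℝ≥0∞}
    (hA : A ≤ ENNReal.ofReal (103 / 100) * N) (hA' : N ≤ ENNReal.ofReal (103 / 100) * A)
    (hB : B ≤ ENNReal.ofReal (103 / 100) * N) (hB' : N ≤ ENNReal.ofReal (103 / 100) * B)
    (hI : ENNReal.ofReal (1 / (2 * ϰ + 1)) * A ^ 2 ≤ I ∧
      I ≤ ENNReal.ofReal (1 / (2 * ϰ - 1)) * A ^ 2)
    (hJ : ENNReal.ofReal (1 / (2 * ϰ + 1)) * B ^ 2 ≤ J ∧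
      J ≤ ENNReal.ofReal (1 / (2 * ϰ - 1)) * B ^ 2) :
    1 / 2 * N ^ 2 ≤ ENNReal.ofReal ϰ * (I + J) ∧ ENNReal.ofReal ϰ * (I + J) ≤ 2 * N ^ 2 := by
  have h0 : (0 : ℝ) ≤ 103 / 100 := by norm_num
  have hϰ0 : 0 ≤ ϰ := by linarith
  have up : ∀ {X Y : ℝ≥0∞}, X ≤ ENNReal.ofReal (103 / 100) * N →
      Y ≤ ENNReal.ofReal (1 / (2 * ϰ - 1)) * X ^ 2 → ENNReal.ofReal ϰ * Y ≤ N ^ 2 := by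
    intro X Y hX hY
    calc ENNReal.ofReal ϰ * Y
        ≤ ENNReal.ofReal ϰ * (ENNReal.ofReal (1 / (2 * ϰ - 1))
          * (ENNReal.ofReal (103 / 100) * N) ^ 2) := by gcongr; exact hY.trans (by gcongr)
      _ = ENNReal.ofReal (ϰ * (1 / (2 * ϰ - 1) * (103 / 100) ^ 2)) * N ^ 2 := by
          rw [mul_pow, ← ENNReal.ofReal_pow h0, ENNReal.ofReal_mul hϰ0,
            ENNReal.ofReal_mul (one_div_nonneg.2 (by linarith))]
          ring
      _ ≤ ENNReal.ofReal 1 * N ^ 2 := by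
          gcongr ENNReal.ofReal ?_ * _
          have h1 : 0 < 2 * ϰ - 1 := by linarith
          rw [← mul_assoc, mul_one_div, div_mul_eq_mul_div, div_le_one h1]
          linarith
      _ = N ^ 2 := by rw [ENNReal.ofReal_one, one_mul]
  have low : ∀ {X Y : ℝ≥0∞}, N ≤ ENNReal.ofReal (103 / 100) * X →
      ENNReal.ofReal (1 / (2 * ϰ + 1)) * X ^ 2 ≤ Y →
        ENNReal.ofReal (1 / 4) * N ^ 2 ≤ ENNReal.ofReal ϰ * Y := by
    intro X Y hX hY
    calc ENNReal.ofReal (1 / 4) * N ^ 2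
        ≤ ENNReal.ofReal (1 / 4) * (ENNReal.ofReal (103 / 100) * X) ^ 2 := by gcongr
      _ = ENNReal.ofReal (1 / 4 * (103 / 100) ^ 2) * X ^ 2 := by
          rw [mul_pow, ← ENNReal.ofReal_pow h0, ENNReal.ofReal_mul (by norm_num)]
          ring
      _ ≤ ENNReal.ofReal (ϰ * (1 / (2 * ϰ + 1))) * X ^ 2 := by
          gcongr ENNReal.ofReal ?_ * _
          rw [mul_one_div, le_div_iff₀ (by linarith)]
          linarith
      _ = ENNReal.ofReal ϰ * (ENNReal.ofReal (1 / (2 * ϰ + 1)) * X ^ 2) := by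
          rw [ENNReal.ofReal_mul hϰ0, mul_assoc]
      _ ≤ ENNReal.ofReal ϰ * Y := by gcongr
  constructor
  · have e : (1 / 2 : ℝ≥0∞) = ENNReal.ofReal (1 / 4) + ENNReal.ofReal (1 / 4) := by
      rw [← ENNReal.ofReal_add (by norm_num) (by norm_num)]
      rw [show (1 / 4 + 1 / 4 : ℝ) = 2⁻¹ by norm_num, ENNReal.ofReal_inv_of_pos (by norm_num)]
      simp
    rw [e, add_mul, mul_add]
    exact add_le_add (low hA' hI.1) (low hB' hJ.1)
  · rw [mul_add, two_mul]
    exact add_le_add (up hA hI.2) (up hB hJ.2)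

end

end LineSchrodinger

open LineSchrodinger in
/-- The usual `H^{-1}` norm, with Fourier weight `(ξ² + 1)⁻¹`, is `sobolevNorm (-1) (1 / 2)`. The
inequalities hold in `[0, ∞]`, since `w` may grow exponentially; the convergence of the series for
`g` and its positivity make the density well defined. -/
theorem lemma5p2 :
    ∃ δ : ℝ, 0 < δ ∧ ∃ ϰ₀ : ℝ, 1 ≤ ϰ₀ ∧
      ∀ w : ℝ → ℝ, (∀ x, 0 < w x) → Differentiable ℝ w → Differentiable ℝ (deriv w) →
        (∀ x, |deriv (deriv w) x| + |deriv w x| ≤ w x) →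
        (∀ x y, w y / w x ≤ Real.exp (|x - y| / 2)) →
      ∀ ϰ : ℝ, ϰ₀ ≤ ϰ → ∀ q : 𝓢(ℝ, ℝ), sobolevNorm (-1) (1 / 2) q < ENNReal.ofReal δ →
        (∀ x, Summable (fun ℓ : ℕ => neumannTerm q ϰ ℓ x x) ∧ 0 < diagGreen q ϰ x) ∧
        (1 / 2) * sobolevNorm (-1) ϰ (fun x => w x * q x) ^ 2
            ≤ eLpNorm (fun x => w x ^ 2 * density q ϰ x) 1 volume ∧
        eLpNorm (fun x => w x ^ 2 * density q ϰ x) 1 volume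
            ≤ 2 * sobolevNorm (-1) ϰ (fun x => w x * q x) ^ 2 := by
  refine ⟨1 / 10, by norm_num, 100, by norm_num, ?_⟩
  intro w hw0 hw hw'd hww hexp ϰ hϰ q hqn
  have hϰ0 : 0 < ϰ := by linarith
  have ha0 : 0 < 2 * ϰ := by linarith
  have hw' : Continuous (deriv w) := hw'd.continuous
  have hw'w : ∀ x, |deriv w x| ≤ w x := fun x =>
    (le_add_of_nonneg_left (abs_nonneg _)).trans (hww x)
  obtain ⟨u, v, hp, hun, hvn, hsum, hρ⟩ := exists_riccatiPair hϰ q.continuous q.integrable hqn.le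
  refine ⟨fun x => ⟨(hsum x).summable, ?_⟩, ?_⟩
  · rw [diagGreen, greenKernel, (hsum x).tsum_eq]
    exact one_div_pos.2 (hp.wronskian_pos hϰ0 x)
  -- everything concerning `v` is read off from the reflected problem
  have hp' := hp.reflect
  have hq' : Continuous fun x => q (-x) := q.continuous.comp continuous_neg
  have hr0 : ∀ x, 0 < w (-x) := fun x => hw0 (-x)
  have hr : Differentiable ℝ fun x => w (-x) := hw.comp differentiable_neg
  have hrd : deriv (fun x => w (-x)) = fun x => -deriv w (-x) := funext fun x => deriv_comp_neg w x
  have hr' : Continuous (deriv fun x => w (-x)) := by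
    rw [hrd]
    exact (hw'.comp continuous_neg).neg
  have hrr : ∀ x, |deriv (fun x => w (-x)) x| ≤ w (-x) := fun x => by
    rw [hrd, abs_neg]
    exact hw'w (-x)
  have hrexp : ∀ x y, w (-y) / w (-x) ≤ Real.exp (|x - y| / 2) := fun x y => by
    refine (hexp (-x) (-y)).trans_eq ?_
    rw [neg_sub_neg, abs_sub_comm]
  have hN : sobolevNorm (-1) ϰ (fun x => w (-x) * q (-x))
      = sobolevNorm (-1) ϰ (fun x => w x * q x) :=
    sobolevNorm_comp_neg (-1) ϰ fun x => w x * q x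
  have hA := eLpNorm_le_sobolevNorm_of_riccati hϰ q.continuous hp.hasDerivAt_left hp.memLp_left hun
    hw hw' hw0 hw'w
  have hA' := sobolevNorm_le_of_riccati hϰ q.continuous hp.hasDerivAt_left hp.memLp_left hun
    hw hw' fun x => (hw'w x).trans (le_abs_self _)
  have hB := eLpNorm_le_sobolevNorm_of_riccati hϰ hq' hp'.hasDerivAt_left hp'.memLp_left hvn
    hr hr' hr0 hrr
  have hB' := sobolevNorm_le_of_riccati hϰ hq' hp'.hasDerivAt_left hp'.memLp_left hvn
    hr hr' fun x => (hrr x).trans (le_abs_self _)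
  rw [hN] at hB hB'
  have hI := lintegral_weight_mul_causal (a := 2 * ϰ) (by linarith) hp.continuous_left
    hp.memLp_left hw.continuous hw0 hexp
  have hJ := lintegral_weight_mul_causal (a := 2 * ϰ) (by linarith) hp'.continuous_left
    hp'.memLp_left hr.continuous hr0 hrexp
  have hmass : eLpNorm (fun x => w x ^ 2 * density q ϰ x) 1 volume
      = ENNReal.ofReal ϰ * ((∫⁻ x, ENNReal.ofReal (w x ^ 2 * causal (2 * ϰ) (fun y => u y ^ 2) x))
        + ∫⁻ x, ENNReal.ofReal (w (-x) ^ 2 * causal (2 * ϰ) (fun y => v (-y) ^ 2) x)) := by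
    have hc := continuous_causal
      (integrableOn_exp_mul_of_integrable ha0 hp.memLp_left.integrable_sq)
    rw [← lintegral_neg_eq_self (μ := volume)
      (fun x => ENNReal.ofReal (w (-x) ^ 2 * causal (2 * ϰ) (fun y => v (-y) ^ 2) x))]
    simp only [neg_neg]
    have hm : Measurable fun x => ENNReal.ofReal (w x ^ 2 * causal (2 * ϰ) (fun y => u y ^ 2) x) :=
      ((hw.continuous.pow 2).mul hc).measurable.ennreal_ofReal
    rw [← lintegral_add_left hm,
      ← lintegral_const_mul' _ _ ENNReal.ofReal_ne_top, eLpNorm_one_eq_lintegral_enorm]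
    refine lintegral_congr fun x => ?_
    have n₁ := causal_nonneg (a := 2 * ϰ) (fun y => sq_nonneg (u y)) x
    have n₂ := causal_nonneg (a := 2 * ϰ) (fun y => sq_nonneg (v (-y))) (-x)
    rw [hρ x, Real.enorm_of_nonneg (by positivity), ← ENNReal.ofReal_add (by positivity)
      (by positivity), ← ENNReal.ofReal_mul hϰ0.le]
    congr 1
    ring
  rw [hmass]
  exact mass_bounds hϰ hA hA' hB hB' hI hJ
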